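/- Let $q$ be a prime power, $0<k<n$, and let $\mathcal C$ be an $[n,k]$ linear code over $\mathbb F_q$ with generator matrix $G$. A set $\mathcal I$ of $k$ coordinates is an information set if $G|_{\mathcal I}$ is invertible. Suppose that $\mathcal C$ is MDS-PIR capacity-achieving: for some positive integers $\kappa,\nu$ with $\kappa/\nu=k/n$ there is a binary $\nu\times n$ matrix, each column of which has Hamming weight $\kappa$, such that the support of each row contains an information set of $\mathcal C$. There are $f$ messages $W^{(1)},\dots,W^{(f)}$, matrices in $\mathbb F_q^{\beta\times k}$ whose $f\beta k$ entries are independent and uniform on $\mathbb F_q$; database $j\in\{1,\dots,n\}$ stores the $j$-th columns of $W^{(1)}G,\dots,W^{(f)}G$. Let $V\in\mathbb F_q^{\mu\times f}$ have rank $r\ge 1$, and let $X^{(v)}=\sum_{m}V_{v,m}W^{(m)}$, $1\le v\le\mu$, be the candidate linear functions, each of $L=\beta k$ symbols. To retrieve $X^{(v)}$ the user sends random queries $Q^{(v)}_1,\dots,Q^{(v)}_n$ (vectors over $\mathbb F_q$), jointly independent of the messages, and database $j$ replies with a vector $A^{(v)}_j$ of $d_j$ symbols of $\mathbb F_q$ that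 is a deterministic function of $Q^{(v)}_j$ and of its content. Such a scheme is a private linear computation (PLC) protocol if for every $v$ - (privacy) $I\bigl(v;\,Q^{(v)}_j,A^{(v)}_j,X^{(1)},\dots,X^{(\mu)}\bigr)=0$ for every single database $j$, where $v$ is drawn at random, with any law, independently of the messages; - (recovery) $H\bigl(X^{(v)}\mid A^{(v)}_1,\dots,A^{(v)}_n,Q^{(v)}_1,\dots,Q^{(v)}_n\bigr)=0$. Its rate is $L/D$, where the download cost $D$ is the number $\sum_j d_j$ of downloaded symbols or, alternatively, the downloaded information $\sum_j H(A^{(v)}_j)$ in $q$-ary units. The PLC capacity $C_{\mathrm{PLC}}$ is the maximum of the rates of all PLC protocols, over all $\beta\ge1$. Then, for either measure of the download cost, the maximum exists and $$C_{\mathrm{PLC}}=\Bigl(1-\frac kn\Bigr)\Bigl[1-\Bigl(\frac kn\Bigr)^r\Bigr]^{-1}.$$ -/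

import Mathlib

namespace PLC

/-! ### Shannon entropy of finitely valued random variables -/

/-- Entropy, in `b`-ary units, of the random variable `X` on the discrete probability space
`(Ω, p)`. -/
noncomputable def entropy (b : ℕ) {Ω α : Type*} [Fintype α] (p : PMF Ω) (X : Ω → α) : ℝ :=
  (∑ a, Real.negMulLog ((p.map X) a).toReal) / Real.log b

/-- Conditional entropy `H(X | Y) = H(X, Y) - H(Y)`. -/
noncomputable def condEntropy (b : ℕ) {Ω α γ : Type*} [Fintype α] [Fintype γ] (p : PMF Ω)
    (X : Ω → α) (Y : Ω → γ) : ℝ :=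
  entropy b p (fun ω => (X ω, Y ω)) - entropy b p Y

/-- Mutual information `I(X ; Y) = H(X) + H(Y) - H(X, Y)`. -/
noncomputable def mutualInfo (b : ℕ) {Ω α γ : Type*} [Fintype α] [Fintype γ] (p : PMF Ω)
    (X : Ω → α) (Y : Ω → γ) : ℝ :=
  entropy b p X + entropy b p Y - entropy b p (fun ω => (X ω, Y ω))

/-! ### Linear codes and PIR achievable rate matrices -/

/-- `G` is a generator matrix of an `[n,k]` code (its row space): its `k` rows are linearly
independent. -/
def IsGeneratorMatrix {F : Type*} [Field F] {k n : ℕ} (G : Matrix (Fin k) (Fin n) F) : Prop :=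
  LinearIndependent F G.row

/-- The coordinate set `I` is an information set: `|I| = k` and `G` restricted to the columns in
`I` is invertible. -/
def IsInformationSet {F : Type*} [Field F] {k n : ℕ} (G : Matrix (Fin k) (Fin n) F)
    (I : Finset (Fin n)) : Prop :=
  ∃ e : Fin k ≃ I, IsUnit (G.submatrix id (fun i => (e i : Fin n)))

/-- The binary `ν × n` matrix `Λ` is a PIR achievable rate matrix `Λ_{κ,ν}` for the code generated
by `G`: every column has Hamming weight `κ`, and the support of every row contains an information
set. -/
def IsPIRAchievableRateMatrix {F : Type*} [Field F] {k n : ℕ} (G : Matrix (Fin k) (Fin n) F)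
    (κ ν : ℕ) (Λ : Matrix (Fin ν) (Fin n) Bool) : Prop :=
  (∀ j, (Finset.univ.filter fun u => Λ u j = true).card = κ) ∧
    ∀ u, ∃ I : Finset (Fin n), IsInformationSet G I ∧ ∀ j ∈ I, Λ u j = true

/-- The code generated by `G` is MDS-PIR capacity-achieving: it has a PIR achievable rate matrix
with `κ / ν = k / n`. -/
def IsMDSPIRCapacityAchieving {F : Type*} [Field F] {k n : ℕ} (G : Matrix (Fin k) (Fin n) F) :
    Prop :=
  ∃ (κ ν : ℕ) (Λ : Matrix (Fin ν) (Fin n) Bool),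
    0 < ν ∧ IsPIRAchievableRateMatrix G κ ν Λ ∧ (κ : ℝ) / ν = (k : ℝ) / n

/-! ### The storage system -/

/-- The `f` messages, each a `β × k` matrix over `F`. -/
abbrev Messages (F : Type*) (f β k : ℕ) : Type _ := Fin f → Matrix (Fin β) (Fin k) F

/-- The content of database `j`: the `j`-th code symbols of all `β f` codewords, the rows of the
matrices `W⁽ᵐ⁾ G`. -/
def stored {F : Type*} [Field F] {n k f β : ℕ} (G : Matrix (Fin k) (Fin n) F)
    (w : Messages F f β k) (j : Fin n) : Fin f → Fin β → F :=
  fun m i => (w m * G) i j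

/-- The candidate linear functions `X⁽ᵛ⁾ = ∑ₘ V_{v,m} W⁽ᵐ⁾` (entrywise on the `β k` symbols). -/
def linFun {F : Type*} [Field F] {k f β μ : ℕ} (V : Matrix (Fin μ) (Fin f) F)
    (w : Messages F f β k) (v : Fin μ) : Matrix (Fin β) (Fin k) F :=
  ∑ m, V v m • w m

/-! ### Schemes and protocols -/

/-- A query-and-answer scheme, before any requirement on privacy or recovery. The query to database
`j` is a vector of `querySize j` symbols over `F`; the user draws all queries from a joint law that
depends on the requested index `v` only. Database `j` replies with `answerSize j` symbols, a
deterministic function of the query it receives and of its content. -/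
structure Scheme (F : Type*) (n f β μ : ℕ) where
  querySize : Fin n → ℕ
  answerSize : Fin n → ℕ
  queryLaw : Fin μ → PMF (∀ j, Fin (querySize j) → F)
  answer : ∀ j, (Fin (querySize j) → F) → (Fin f → Fin β → F) → (Fin (answerSize j) → F)

namespace Scheme

variable {F : Type*} {n f β μ : ℕ}

/-- The possible query tuples of a scheme. -/
abbrev Queries (P : Scheme F n f β μ) : Type _ := ∀ j, Fin (P.querySize j) → F

/-- The joint law of messages and queries when function `v` is requested: the message symbols are
independent and uniform on `F`, and the queries are independent of the messages. -/
noncomputable def law [Field F] [Fintype F] (k : ℕ) (P : Scheme F n f β μ) (v : Fin μ) :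
    PMF (Messages F f β k × P.Queries) :=
  (PMF.uniformOfFintype (Messages F f β k)).bind fun w =>
    (P.queryLaw v).map fun q => (w, q)

/-- The joint law of requested index, messages and queries when the index has law `θ`. -/
noncomputable def jointLaw [Field F] [Fintype F] (k : ℕ) (P : Scheme F n f β μ)
    (θ : PMF (Fin μ)) : PMF (Fin μ × Messages F f β k × P.Queries) :=
  θ.bind fun v => (P.law k v).map fun x => (v, x)

/-- The answer of database `j`, for given messages and queries. -/
def reply [Field F] {k : ℕ} (P : Scheme F n f β μ) (G : Matrix (Fin k) (Fin n) F)
    (x : Messages F f β k × P.Queries) (j : Fin n) : Fin (P.answerSize j) → F :=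
  P.answer j (x.2 j) (stored G x.1 j)

/-- Privacy: for each database `j`, `I(v ; Q_j, A_j, X⁽¹⁾, …, X⁽ᵘ⁾) = 0`, whatever the law of the
requested index `v`. -/
def IsPrivate [Field F] [Fintype F] {k : ℕ} (P : Scheme F n f β μ)
    (G : Matrix (Fin k) (Fin n) F) (V : Matrix (Fin μ) (Fin f) F) : Prop :=
  ∀ (θ : PMF (Fin μ)) (j : Fin n),
    mutualInfo (Fintype.card F) (P.jointLaw k θ) (fun x => x.1)
      (fun x => (x.2.2 j, P.reply G x.2 j, linFun V x.2.1)) = 0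

/-- Recovery: `H(X⁽ᵛ⁾ | A_1, …, A_n, Q_1, …, Q_n) = 0` for every requested index `v`. -/
def IsRecoverable [Field F] [Fintype F] {k : ℕ} (P : Scheme F n f β μ)
    (G : Matrix (Fin k) (Fin n) F) (V : Matrix (Fin μ) (Fin f) F) : Prop :=
  ∀ v : Fin μ,
    condEntropy (Fintype.card F) (P.law k v) (fun x => linFun V x.1 v)
      (fun x => (P.reply G x, x.2)) = 0

end Scheme

/-- A private linear computation protocol, with messages of `L = β k` symbols, for the storage code
generated by `G` and the coefficient matrix `V`. -/
structure Protocol {F : Type*} [Field F] [Fintype F] {n k f μ : ℕ}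
    (G : Matrix (Fin k) (Fin n) F) (V : Matrix (Fin μ) (Fin f) F) (β : ℕ)
    extends Scheme F n f β μ where
  isPrivate : toScheme.IsPrivate G V
  isRecoverable : toScheme.IsRecoverable G V

namespace Protocol

variable {F : Type*} [Field F] [Fintype F] {n k f μ β : ℕ}
  {G : Matrix (Fin k) (Fin n) F} {V : Matrix (Fin μ) (Fin f) F}

/-- The rate `L / D`, where `D` is the total number of downloaded symbols. -/
noncomputable def rate (P : Protocol G V β) : ℝ :=
  ((β * k : ℕ) : ℝ) / ∑ j, (P.answerSize j : ℝ)

/-- The rate `L / D`, where `D = ∑ⱼ H(Aⱼ⁽ᵛ⁾)` is the total amount of downloaded information, in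
`q`-ary units, when function `v` is requested (by privacy, the same for all `v`). -/
noncomputable def entropyRate (P : Protocol G V β) (v : Fin μ) : ℝ :=
  ((β * k : ℕ) : ℝ) /
    ∑ j, entropy (Fintype.card F) (P.law k v) (fun x => P.reply G x j)

end Protocol

/-- `C` is the private linear computation capacity for the storage code generated by `G` and the
coefficient matrix `V`: the maximum of the rates of all protocols, of any message length, where the
download cost may be measured by the number of downloaded symbols or by the entropy of the answers;
`C` is the maximum for either measure. -/
def IsCapacity {F : Type*} [Field F] [Fintype F] {n k f μ : ℕ}
    (G : Matrix (Fin k) (Fin n) F) (V : Matrix (Fin μ) (Fin f) F) (C : ℝ) : Prop :=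
  IsGreatest {R : ℝ | ∃ β : ℕ, 0 < β ∧ ∃ P : Protocol G V β, R = P.rate} C ∧
    IsGreatest {R : ℝ | ∃ β : ℕ, 0 < β ∧ ∃ P : Protocol G V β, ∃ v, R = P.entropyRate v} C

end PLC

/-!
Converse. Given the functions in `S`, decoding a further linearly independent function from the
answers yields `L` symbols of information. By privacy the law of a single answer does not depend on
the request, so one may then continue with another request. Since the contents of the databases in
an information set are independent, so are their answers, and averaging over `ν` information sets
which cover each database `κ` times shows that changing the request costs a factor of at most
`κ / ν`. Peeling off `r` independent functions gives `D ≥ L (1 + κ / ν + ⋯ + (κ / ν) ^ (r - 1))`.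

Achievability. Let `E` be the row space of `V` and `F × B ≃ E` an isomorphism sending `(1, 0)` to
the requested function. A uniformly random isomorphism turns the message columns into families of
blocks: alternating forms on `B`, several in each degree for every information set. Database `j` is
sent alternating forms on `E` whose restrictions to `B` are the blocks of the information sets
containing `j`, and whose contractions with `(1, 0)` are the blocks, of degree one less, of the
others. Applied to its content, these become linear families of forms parametrised by `E`, and the
database answers with their alternations. The restrictions of the answers on an information set
reveal the alternations of its blocks. The contraction of an answer is the value of a block at
`(1, 0)` minus the alternation of a block of another information set, which is therefore known; what
is left on each information set reveals the requested function. A form can have any restriction and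
contraction, so the forms sent to a single database have the same law for every request.
-/

namespace PLC

/-! ### Entropy -/

section Entropy

variable {Ω α γ δ : Type*} {b : ℕ}

/-- The probability of the event `X = a`, as a real number. -/
noncomputable def prob (p : PMF Ω) (X : Ω → α) (a : α) : ℝ := ((p.map X) a).toReal

theorem prob_nonneg (p : PMF Ω) (X : Ω → α) (a : α) : 0 ≤ prob p X a := ENNReal.toReal_nonneg

theorem prob_pos_iff {p : PMF Ω} {X : Ω → α} {a : α} :
    0 < prob p X a ↔ ∃ ω ∈ p.support, X ω = a := by
  rw [← PMF.mem_support_map_iff X p a, PMF.mem_support_iff, prob, ENNReal.toReal_pos_iff]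
  exact ⟨fun h => h.1.ne', fun h => ⟨pos_iff_ne_zero.2 h, PMF.apply_lt_top _ _⟩⟩

theorem prob_le_prob_comp (p : PMF Ω) (X : Ω → α) (g : α → γ) (a : α) :
    prob p X a ≤ prob p (fun ω => g (X ω)) (g a) := by
  refine ENNReal.toReal_mono (PMF.apply_ne_top _ _) ?_
  rw [← Function.comp_def g X, ← PMF.map_comp, PMF.map_apply g (p.map X)]
  exact (if_pos rfl).ge.trans (ENNReal.le_tsum a)

theorem sum_prob_prodMk_left [Fintype α] (p : PMF Ω) (X : Ω → α) (Y : Ω → γ) (c : γ) :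
    ∑ a, prob p (fun ω => (X ω, Y ω)) (a, c) = prob p Y c := by
  classical
  have map_eq : p.map Y = (p.map fun ω => (X ω, Y ω)).map Prod.snd := by
    rw [PMF.map_comp]
    rfl
  simp only [prob]
  rw [← ENNReal.toReal_sum fun a _ => PMF.apply_ne_top _ _, map_eq, PMF.map_apply,
    ENNReal.tsum_prod', tsum_fintype]
  simp

variable [Fintype α] [Fintype γ] [Fintype δ]

theorem sum_prob (p : PMF Ω) (X : Ω → α) : ∑ a, prob p X a = 1 := by
  rw [← ENNReal.toReal_one, ← (p.map X).tsum_coe, tsum_fintype,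
    ENNReal.toReal_sum fun a _ => PMF.apply_ne_top _ a]
  rfl

theorem sum_prob_comp_mul (p : PMF Ω) (X : Ω → α) (g : α → γ) (φ : γ → ℝ) :
    ∑ c, prob p (fun ω => g (X ω)) c * φ c = ∑ a, prob p X a * φ (g a) := by
  classical
  have prob_comp : ∀ c, prob p (fun ω => g (X ω)) c = ∑ a, if c = g a then prob p X a else 0 := by
    intro c
    rw [prob, show (fun ω => g (X ω)) = g ∘ X from rfl, ← PMF.map_comp, PMF.map_apply,
      tsum_fintype, ENNReal.toReal_sum fun a _ => by
        split_ifs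
        exacts [PMF.apply_ne_top _ a, ENNReal.zero_ne_top]]
    exact Finset.sum_congr rfl fun a _ => by split_ifs <;> rfl
  simp_rw [prob_comp, Finset.sum_mul]
  rw [Finset.sum_comm]
  simp

theorem entropy_comp (b : ℕ) (p : PMF Ω) (X : Ω → α) (g : α → γ) :
    entropy b p (fun ω => g (X ω)) =
      (∑ a, prob p X a * -Real.log (prob p (fun ω => g (X ω)) (g a))) / Real.log b := by
  rw [← sum_prob_comp_mul p X g fun c => -Real.log (prob p (fun ω => g (X ω)) c)]
  simp [entropy, Real.negMulLog, prob]

theorem entropy_eq_sum (b : ℕ) (p : PMF Ω) (X : Ω → α) :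
    entropy b p X = (∑ a, prob p X a * -Real.log (prob p X a)) / Real.log b :=
  entropy_comp b p X id

theorem entropy_congr {Ω' : Type*} {p : PMF Ω} {p' : PMF Ω'} {X : Ω → α} {X' : Ω' → α}
    (h : p.map X = p'.map X') : entropy b p X = entropy b p' X' := by
  rw [entropy, entropy, h]

theorem condEntropy_congr {Ω' : Type*} {p : PMF Ω} {p' : PMF Ω'} {X : Ω → α} {X' : Ω' → α}
    {Y : Ω → γ} {Y' : Ω' → γ}
    (h : p.map (fun ω => (X ω, Y ω)) = p'.map (fun ω => (X' ω, Y' ω))) :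
    condEntropy b p X Y = condEntropy b p' X' Y' := by
  have hY : p.map Y = p'.map Y' := by
    simpa only [PMF.map_comp, Function.comp_def] using congrArg (PMF.map Prod.snd) h
  rw [condEntropy, condEntropy, entropy_congr h, entropy_congr hY]

theorem entropy_comp_le (b : ℕ) (p : PMF Ω) (X : Ω → α) (g : α → γ) :
    entropy b p (fun ω => g (X ω)) ≤ entropy b p X := by
  rw [entropy_comp, entropy_eq_sum]
  refine div_le_div_of_nonneg_right (Finset.sum_le_sum fun a _ => ?_) (Real.log_natCast_nonneg b)
  rcases (prob_nonneg p X a).eq_or_lt with h | h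
  · simp [← h]
  · exact mul_le_mul_of_nonneg_left
      (neg_le_neg (Real.log_le_log h (prob_le_prob_comp p X g a))) h.le

theorem entropy_const (b : ℕ) (p : PMF Ω) (c : γ) : entropy b p (fun _ => c) = 0 := by
  have hmap : p.map (fun _ => c) = PMF.pure c := PMF.map_const p c
  rw [entropy_comp b p (fun _ => ()) fun _ => c]
  simp [prob, hmap]

theorem condEntropy_nonneg (b : ℕ) (p : PMF Ω) (X : Ω → α) (Y : Ω → γ) :
    0 ≤ condEntropy b p X Y :=
  sub_nonneg.2 (entropy_comp_le b p (fun ω => (X ω, Y ω)) Prod.snd)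

/-! ### Gibbs' inequality and its consequences -/

theorem mul_klFun_div {s t : ℝ} (hst : t = 0 → s = 0) :
    t * InformationTheory.klFun (s / t) = s * -Real.log t - s * -Real.log s + t - s := by
  rcases eq_or_ne t 0 with rfl | ht
  · simp [hst rfl]
  rcases eq_or_ne s 0 with rfl | hs
  · simp [InformationTheory.klFun]
  rw [InformationTheory.klFun, Real.log_div hs ht]
  field_simp
  ring

section Gibbs

variable {p : PMF Ω} {X : Ω → α} {t : α → ℝ}

theorem sum_mul_klFun_prob_div (ht : ∀ a, t a = 0 → prob p X a = 0) :
    ∑ a, t a * InformationTheory.klFun (prob p X a / t a) =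
      ∑ a, prob p X a * -Real.log (t a) - ∑ a, prob p X a * -Real.log (prob p X a) +
        ∑ a, t a - 1 := by
  simp_rw [mul_klFun_div (ht _), Finset.sum_sub_distrib, Finset.sum_add_distrib,
    Finset.sum_sub_distrib, sum_prob]

omit [Fintype α] in
theorem mul_klFun_prob_div_nonneg (ht0 : ∀ a, 0 ≤ t a) (a : α) :
    0 ≤ t a * InformationTheory.klFun (prob p X a / t a) :=
  mul_nonneg (ht0 a) (InformationTheory.klFun_nonneg (div_nonneg (prob_nonneg p X a) (ht0 a)))

theorem entropy_le_crossEntropy (b : ℕ) (ht0 : ∀ a, 0 ≤ t a) (ht1 : ∑ a, t a ≤ 1)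
    (ht : ∀ a, t a = 0 → prob p X a = 0) :
    entropy b p X ≤ (∑ a, prob p X a * -Real.log (t a)) / Real.log b := by
  have divergence_nonneg := Finset.sum_nonneg fun a (_ : a ∈ Finset.univ) =>
    mul_klFun_prob_div_nonneg (p := p) (X := X) ht0 a
  rw [sum_mul_klFun_prob_div ht] at divergence_nonneg
  rw [entropy_eq_sum]
  exact div_le_div_of_nonneg_right (by linarith) (Real.log_natCast_nonneg b)

theorem prob_eq_of_crossEntropy_le_entropy (hb : 1 < b) (ht0 : ∀ a, 0 ≤ t a)
    (ht1 : ∑ a, t a ≤ 1) (ht : ∀ a, t a = 0 → prob p X a = 0)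
    (h : (∑ a, prob p X a * -Real.log (t a)) / Real.log b ≤ entropy b p X) (a : α) :
    prob p X a = t a := by
  have divergence_eq_zero : ∑ a, t a * InformationTheory.klFun (prob p X a / t a) = 0 := by
    refine le_antisymm ?_ (Finset.sum_nonneg fun a _ => mul_klFun_prob_div_nonneg ht0 a)
    rw [entropy_eq_sum, div_le_div_iff_of_pos_right (Real.log_pos (Nat.one_lt_cast.2 hb))] at h
    rw [sum_mul_klFun_prob_div ht]
    linarith
  have term_eq_zero := (Finset.sum_eq_zero_iff_of_nonneg fun a _ =>
    mul_klFun_prob_div_nonneg ht0 a).1 divergence_eq_zero a (Finset.mem_univ a)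
  rcases mul_eq_zero.1 term_eq_zero with h0 | h0
  · rw [h0, ht a h0]
  · rw [InformationTheory.klFun_eq_zero_iff (div_nonneg (prob_nonneg p X a) (ht0 a))] at h0
    exact eq_of_div_eq_one h0

end Gibbs

theorem entropy_le_log_card_div_log (b : ℕ) (p : PMF Ω) (X : Ω → α) :
    entropy b p X ≤ Real.log (Fintype.card α) / Real.log b := by
  obtain ⟨ω, -⟩ := p.support_nonempty
  have : Nonempty α := ⟨X ω⟩
  have hcard : (Fintype.card α : ℝ) ≠ 0 := Nat.cast_ne_zero.2 Fintype.card_ne_zero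
  refine (entropy_le_crossEntropy b (t := fun _ => (Fintype.card α : ℝ)⁻¹) (fun _ => by positivity)
    (by simp [hcard]) fun _ h => absurd h (inv_ne_zero hcard)).trans_eq ?_
  rw [← Finset.sum_mul, sum_prob, one_mul, Real.log_inv, neg_neg]

theorem mul_neg_log_mul {s x y : ℝ} (hs : 0 ≤ s) (hx : s ≤ x) (hy : s ≤ y) :
    s * -Real.log (x * y) = s * -Real.log x + s * -Real.log y := by
  rcases hs.eq_or_lt with rfl | hs
  · simp
  rw [Real.log_mul (hs.trans_le hx).ne' (hs.trans_le hy).ne']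
  ring

theorem mul_neg_log_mul_div {s x y z : ℝ} (hs : 0 ≤ s) (hx : s ≤ x) (hy : s ≤ y) (hz : s ≤ z) :
    s * -Real.log (x * y / z) = s * -Real.log x + s * -Real.log y - s * -Real.log z := by
  rw [← mul_neg_log_mul hs hx hy]
  rcases hs.eq_or_lt with rfl | hs
  · simp
  rw [Real.log_div (mul_pos (hs.trans_le hx) (hs.trans_le hy)).ne' (hs.trans_le hz).ne']
  ring

theorem condEntropy_prodMk_le (b : ℕ) (p : PMF Ω) (X : Ω → α) (Y : Ω → γ) (Z : Ω → δ) :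
    condEntropy b p X (fun ω => (Y ω, Z ω)) ≤ condEntropy b p X Z := by
  set T : Ω → α × γ × δ := fun ω => (X ω, Y ω, Z ω)
  let P_XZ (a : α × γ × δ) : ℝ := prob p (fun ω => (X ω, Z ω)) (a.1, a.2.2)
  let P_YZ (a : α × γ × δ) : ℝ := prob p (fun ω => (Y ω, Z ω)) a.2
  let P_Z (a : α × γ × δ) : ℝ := prob p Z a.2.2
  have T_le_XZ : ∀ a, prob p T a ≤ P_XZ a := prob_le_prob_comp p T fun a => (a.1, a.2.2)
  have T_le_YZ : ∀ a, prob p T a ≤ P_YZ a := prob_le_prob_comp p T Prod.snd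
  have T_le_Z : ∀ a, prob p T a ≤ P_Z a := prob_le_prob_comp p T fun a => a.2.2
  have sum_le_one : ∑ a, P_XZ a * P_YZ a / P_Z a ≤ 1 := by
    rw [← sum_prob p fun ω => (Y ω, Z ω), Fintype.sum_prod_type, Finset.sum_comm]
    refine Finset.sum_le_sum fun c _ => ?_
    change ∑ a, prob p (fun ω => (X ω, Z ω)) (a, c.2) * prob p (fun ω => (Y ω, Z ω)) c /
      prob p Z c.2 ≤ _
    rw [← Finset.sum_div, ← Finset.sum_mul, sum_prob_prodMk_left, mul_div_right_comm]
    exact mul_le_of_le_one_left (prob_nonneg _ _ _) (div_self_le_one _)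
  have cross_le := entropy_le_crossEntropy b (p := p) (X := T)
    (fun a => div_nonneg (mul_nonneg (prob_nonneg _ _ _) (prob_nonneg _ _ _)) (prob_nonneg _ _ _))
    sum_le_one fun a ha => by
      have := prob_nonneg p T a
      rcases div_eq_zero_iff.1 ha with h | h
      · rcases mul_eq_zero.1 h with h | h <;> linarith [T_le_XZ a, T_le_YZ a]
      · linarith [T_le_Z a]
  rw [Finset.sum_congr rfl fun a _ =>
    mul_neg_log_mul_div (prob_nonneg p T a) (T_le_XZ a) (T_le_YZ a) (T_le_Z a),
    Finset.sum_sub_distrib, Finset.sum_add_distrib, sub_div, add_div,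
    ← entropy_comp b p T fun a => (a.1, a.2.2), ← entropy_comp b p T Prod.snd,
    ← entropy_comp b p T fun a => a.2.2] at cross_le
  unfold condEntropy
  linarith

theorem mutualInfo_eq_zero_iff (hb : 1 < b) {p : PMF Ω} {X : Ω → α} {Y : Ω → γ} :
    mutualInfo b p X Y = 0 ↔
      ∀ a c, prob p (fun ω => (X ω, Y ω)) (a, c) = prob p X a * prob p Y c := by
  set T : Ω → α × γ := fun ω => (X ω, Y ω)
  have T_le_X : ∀ a, prob p T a ≤ prob p X a.1 := prob_le_prob_comp p T Prod.fst
  have T_le_Y : ∀ a, prob p T a ≤ prob p Y a.2 := prob_le_prob_comp p T Prod.snd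
  have cross_eq : (∑ a, prob p T a * -Real.log (prob p X a.1 * prob p Y a.2)) / Real.log b =
      entropy b p X + entropy b p Y := by
    rw [Finset.sum_congr rfl fun a _ => mul_neg_log_mul (prob_nonneg p T a) (T_le_X a) (T_le_Y a),
      Finset.sum_add_distrib, add_div, ← entropy_comp b p T Prod.fst, ← entropy_comp b p T Prod.snd]
  rw [mutualInfo, sub_eq_zero, ← cross_eq]
  constructor
  · intro h a c
    refine prob_eq_of_crossEntropy_le_entropy hb
      (fun a => mul_nonneg (prob_nonneg _ _ _) (prob_nonneg _ _ _)) ?_ (fun a ha => ?_) h.le (a, c)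
    · simp [Fintype.sum_prod_type, ← Finset.mul_sum, sum_prob]
    · have := prob_nonneg p T a
      rcases mul_eq_zero.1 ha with h | h <;> linarith [T_le_X a, T_le_Y a]
  · intro h
    rw [entropy_eq_sum b p T]
    refine congrArg (· / Real.log b) (Finset.sum_congr rfl fun a _ => ?_)
    rw [← h a.1 a.2]

/-- Almost surely, the value of `X` determines the value of `Y`. -/
def Determines (p : PMF Ω) (X : Ω → α) (Y : Ω → γ) : Prop :=
  ∀ ω ∈ p.support, ∀ ω' ∈ p.support, X ω = X ω' → Y ω = Y ω'

omit [Fintype α] [Fintype γ] in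
theorem Determines.of_comp {p : PMF Ω} {X : Ω → α} {Y : Ω → γ} (g : α → γ)
    (h : ∀ ω, Y ω = g (X ω)) : Determines p X Y :=
  fun ω _ ω' _ hX => by rw [h, h, hX]

omit [Fintype α] [Fintype γ] in
theorem determines_iff_prob_prodMk [Finite α] {p : PMF Ω} {X : Ω → α} {Y : Ω → γ} :
    Determines p Y X ↔ ∀ a c, 0 < prob p (fun ω => (X ω, Y ω)) (a, c) →
      prob p (fun ω => (X ω, Y ω)) (a, c) = prob p Y c := by
  classical
  cases nonempty_fintype α
  constructor
  · intro h a c hac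
    rw [← sum_prob_prodMk_left p X Y c]
    refine Eq.symm (Finset.sum_eq_single_of_mem a (Finset.mem_univ a) fun a' _ ha' => ?_)
    refine ((prob_nonneg _ _ _).eq_or_lt.resolve_right fun ha'c => ha' ?_).symm
    obtain ⟨ω, hω, e⟩ := prob_pos_iff.1 hac
    obtain ⟨ω', hω', e'⟩ := prob_pos_iff.1 ha'c
    simp only [Prod.mk.injEq] at e e'
    rw [← e.1, ← e'.1]
    exact h ω' hω' ω hω (e'.2.trans e.2.symm)
  · intro h ω hω ω' hω' hY
    by_contra hne
    have pos : ∀ ω₀ ∈ p.support, 0 < prob p (fun ω => (X ω, Y ω)) (X ω₀, Y ω₀) := fun ω₀ h₀ =>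
      prob_pos_iff.2 ⟨ω₀, h₀, rfl⟩
    have sum_le : ∑ a ∈ {X ω, X ω'}, prob p (fun ω => (X ω, Y ω)) (a, Y ω) ≤ prob p Y (Y ω) := by
      rw [← sum_prob_prodMk_left p X Y (Y ω)]
      exact Finset.sum_le_sum_of_subset_of_nonneg (Finset.subset_univ _) fun a _ _ =>
        prob_nonneg _ _ _
    rw [Finset.sum_pair hne, h _ _ (pos ω hω), hY] at sum_le
    linarith [pos ω' hω']

theorem condEntropy_eq_sum (b : ℕ) (p : PMF Ω) (X : Ω → α) (Y : Ω → γ) :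
    condEntropy b p X Y = (∑ a : α × γ, prob p (fun ω => (X ω, Y ω)) a *
      (Real.log (prob p Y a.2) - Real.log (prob p (fun ω => (X ω, Y ω)) a))) / Real.log b := by
  rw [condEntropy, entropy_eq_sum, entropy_comp b p (fun ω => (X ω, Y ω)) Prod.snd, ← sub_div,
    ← Finset.sum_sub_distrib]
  simp_rw [← mul_sub, neg_sub_neg]

theorem Determines.condEntropy_eq_zero {p : PMF Ω} {X : Ω → α} {Y : Ω → γ}
    (h : Determines p Y X) : condEntropy b p X Y = 0 := by
  rw [condEntropy_eq_sum, Finset.sum_eq_zero, zero_div]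
  intro a _
  rcases (prob_nonneg p (fun ω => (X ω, Y ω)) a).eq_or_lt with h0 | h0
  · rw [← h0, zero_mul]
  · rw [determines_iff_prob_prodMk.1 h a.1 a.2 h0, sub_self, mul_zero]

theorem condEntropy_eq_zero_iff (hb : 1 < b) {p : PMF Ω} {X : Ω → α} {Y : Ω → γ} :
    condEntropy b p X Y = 0 ↔ Determines p Y X := by
  refine ⟨fun h => determines_iff_prob_prodMk.2 fun a c hac => ?_, Determines.condEntropy_eq_zero⟩
  have joint_le : ∀ a, prob p (fun ω => (X ω, Y ω)) a ≤ prob p Y a.2 :=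
    prob_le_prob_comp p (fun ω => (X ω, Y ω)) Prod.snd
  have term_nonneg : ∀ a : α × γ, 0 ≤ prob p (fun ω => (X ω, Y ω)) a *
      (Real.log (prob p Y a.2) - Real.log (prob p (fun ω => (X ω, Y ω)) a)) := by
    intro a
    rcases (prob_nonneg p (fun ω => (X ω, Y ω)) a).eq_or_lt with h0 | h0
    · rw [← h0, zero_mul]
    · exact mul_nonneg h0.le (sub_nonneg.2 (Real.log_le_log h0 (joint_le a)))
  rw [condEntropy_eq_sum, div_eq_zero_iff, or_iff_left (Real.log_pos (Nat.one_lt_cast.2 hb)).ne',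
    Finset.sum_eq_zero_iff_of_nonneg fun a _ => term_nonneg a] at h
  have log_eq := (mul_eq_zero.1 (h (a, c) (Finset.mem_univ _))).resolve_left hac.ne'
  exact (Real.log_injOn_pos (hac.trans_le (joint_le (a, c))) hac (sub_eq_zero.1 log_eq)).symm

theorem Determines.entropy_le {p : PMF Ω} {X : Ω → α} {Y : Ω → γ} (h : Determines p X Y) :
    entropy b p Y ≤ entropy b p X :=
  (entropy_comp_le b p (fun ω => (Y ω, X ω)) Prod.fst).trans_eq
    (sub_eq_zero.1 h.condEntropy_eq_zero)

theorem Determines.condEntropy_le_left {p : PMF Ω} {X : Ω → α} {Y : Ω → γ} {Z : Ω → δ}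
    (h : Determines p (fun ω => (X ω, Z ω)) Y) : condEntropy b p Y Z ≤ condEntropy b p X Z :=
  have pair : Determines p (fun ω => (X ω, Z ω)) fun ω => (Y ω, Z ω) := fun ω hω ω' hω' e =>
    Prod.ext (h ω hω ω' hω' e) (Prod.ext_iff.1 e).2
  sub_le_sub_right pair.entropy_le _

theorem Determines.condEntropy_le_right {p : PMF Ω} {X : Ω → α} {Y : Ω → γ} {Z : Ω → δ}
    (h : Determines p Y Z) : condEntropy b p X Y ≤ condEntropy b p X Z := by
  refine le_trans ?_ (condEntropy_prodMk_le b p X Y Z)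
  refine sub_le_sub (entropy_comp_le b p (fun ω => (X ω, Y ω, Z ω)) fun t => (t.1, t.2.1))
    (Determines.entropy_le fun ω hω ω' hω' e => Prod.ext e (h ω hω ω' hω' e))

theorem condEntropy_le_entropy (b : ℕ) (p : PMF Ω) (X : Ω → α) (Y : Ω → γ) :
    condEntropy b p X Y ≤ entropy b p X := by
  have h : Determines p Y fun _ => () := .of_comp (fun _ => ()) fun _ => rfl
  refine h.condEntropy_le_right.trans ?_
  rw [condEntropy, entropy_const, sub_zero]
  exact entropy_comp_le b p X fun a => (a, ())

theorem condEntropy_prodMk (b : ℕ) (p : PMF Ω) (X : Ω → α) (Y : Ω → γ) (Z : Ω → δ) :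
    condEntropy b p (fun ω => (X ω, Y ω)) Z =
      condEntropy b p X (fun ω => (Y ω, Z ω)) + condEntropy b p Y Z := by
  have assoc : entropy b p (fun ω => ((X ω, Y ω), Z ω)) = entropy b p (fun ω => (X ω, Y ω, Z ω)) :=
    le_antisymm (entropy_comp_le b p (fun ω => (X ω, Y ω, Z ω)) fun t => ((t.1, t.2.1), t.2.2))
      (entropy_comp_le b p (fun ω => ((X ω, Y ω), Z ω)) fun t => (t.1.1, t.1.2, t.2))
  unfold condEntropy
  rw [assoc]
  ring

theorem condEntropy_restrict_le {ι : Type*} [DecidableEq ι] {κ : ι → Type*} [∀ i, Fintype (κ i)]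
    (b : ℕ) (p : PMF Ω) (Y : Ω → ∀ i, κ i) (Z : Ω → δ) (s : Finset ι) :
    condEntropy b p (fun ω => s.restrict (Y ω)) Z ≤
      ∑ i ∈ s, condEntropy b p (fun ω => Y ω i) Z := by
  induction s using Finset.induction_on with
  | empty =>
    have h : Determines p Z fun ω => (∅ : Finset ι).restrict (Y ω) :=
      fun _ _ _ _ _ => Subsingleton.elim _ _
    rw [Finset.sum_empty, h.condEntropy_eq_zero]
  | insert a s ha ih =>
    have split : Determines p (fun ω => ((Y ω a, s.restrict (Y ω)), Z ω))
        fun ω => (insert a s).restrict (Y ω) := by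
      intro ω _ ω' _ e
      simp only [Prod.mk.injEq] at e
      funext ⟨i, hi⟩
      rcases Finset.mem_insert.1 hi with rfl | hi
      exacts [e.1.1, congrFun e.1.2 ⟨i, hi⟩]
    rw [Finset.sum_insert ha]
    refine split.condEntropy_le_left.trans ?_
    rw [condEntropy_prodMk]
    exact add_le_add (condEntropy_prodMk_le b p _ _ Z) ih

end Entropy

/-! ### Mixtures and uniform variables -/

section Mixture

variable {ι α γ : Type*}

theorem bind_map_prodMk_apply (θ : PMF ι) (K : ι → PMF α) (i : ι) (a : α) :
    (θ.bind fun i => (K i).map fun a => (i, a)) (i, a) = θ i * K i a := by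
  classical
  rw [PMF.bind_apply, tsum_eq_single i]
  · rw [PMF.map_apply, tsum_eq_single a]
    · rw [if_pos rfl]
    · exact fun b hb => if_neg fun e => hb (Prod.ext_iff.1 e).2.symm
  · intro i' hi'
    simp [PMF.map_apply, hi'.symm]

theorem map_fst_bind_map_prodMk (θ : PMF ι) (K : ι → PMF α) :
    (θ.bind fun i => (K i).map fun a => (i, a)).map Prod.fst = θ := by
  have map_fst : ∀ i, ((K i).map fun a => (i, a)).map Prod.fst = PMF.pure i := fun i => by
    rw [PMF.map_comp]
    exact PMF.map_const (K i) i
  rw [PMF.map_bind]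
  simp_rw [map_fst]
  exact PMF.bind_pure θ

theorem map_snd_bind_map_prodMk (θ : PMF ι) (K : ι → PMF α) :
    (θ.bind fun i => (K i).map fun a => (i, a)).map Prod.snd = θ.bind K := by
  rw [PMF.map_bind]
  refine congrArg θ.bind (funext fun i => ?_)
  rw [PMF.map_comp]
  exact PMF.map_id (K i)

theorem map_bind_map_prodMk (θ : PMF ι) (K : ι → PMF α) (Y : α → γ) :
    (θ.bind fun i => (K i).map fun a => (i, a)).map (fun x => (x.1, Y x.2)) =
      θ.bind fun i => ((K i).map Y).map fun c => (i, c) := by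
  rw [PMF.map_bind]
  simp_rw [PMF.map_comp]
  rfl

theorem map_equiv_uniformOfFintype [Fintype α] [Nonempty α] [Fintype γ] [Nonempty γ] (e : α ≃ γ) :
    (PMF.uniformOfFintype α).map e = PMF.uniformOfFintype γ := by
  ext c
  rw [PMF.map_apply, tsum_eq_single (e.symm c) fun a ha => if_neg fun h => ha (by simp [h])]
  simp [Fintype.card_congr e]

theorem mutualInfo_bind_eq_zero_iff [Fintype ι] [Fintype γ] {b : ℕ} (hb : 1 < b) (θ : PMF ι)
    (K : ι → PMF α) (Y : α → γ) :
    mutualInfo b (θ.bind fun i => (K i).map fun a => (i, a)) (fun x => x.1) (fun x => Y x.2) = 0 ↔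
      ∀ i ∈ θ.support, ∀ i' ∈ θ.support, (K i).map Y = (K i').map Y := by
  set p := θ.bind fun i => (K i).map fun a => (i, a) with hp
  have map_snd : p.map (fun x => Y x.2) = θ.bind fun i => (K i).map Y := by
    rw [← PMF.map_bind, ← map_snd_bind_map_prodMk θ K, PMF.map_comp]
    rfl
  have indep_iff : mutualInfo b p (fun x => x.1) (fun x => Y x.2) = 0 ↔
      ∀ i ∈ θ.support, (K i).map Y = θ.bind fun i => (K i).map Y := by
    rw [mutualInfo_eq_zero_iff hb]
    refine forall_congr' fun i => ?_
    have map_fst : p.map (fun x => x.1) = θ := map_fst_bind_map_prodMk θ K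
    simp_rw [prob, hp, map_bind_map_prodMk, ← hp, bind_map_prodMk_apply, map_fst, map_snd,
      ENNReal.toReal_mul]
    by_cases hi : θ i = 0
    · simp [hi]
    · have toReal_ne : (θ i).toReal ≠ 0 := ENNReal.toReal_ne_zero.2 ⟨hi, θ.apply_ne_top i⟩
      simp only [mul_right_inj' toReal_ne, PMF.mem_support_iff, ne_eq, hi, not_false_eq_true,
        forall_const, PMF.ext_iff]
      exact forall_congr' fun c =>
        ENNReal.toReal_eq_toReal_iff' (PMF.apply_ne_top _ c) (PMF.apply_ne_top _ c)
  rw [indep_iff]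
  refine ⟨fun h i hi i' hi' => (h i hi).trans (h i' hi').symm, fun h i hi => PMF.ext fun c => ?_⟩
  have mul_eq : ∀ i', θ i' * (K i').map Y c = θ i' * (K i).map Y c := by
    intro i'
    by_cases hi' : θ i' = 0
    · simp [hi']
    · rw [h i' hi' i hi]
  rw [PMF.bind_apply, tsum_congr mul_eq, ENNReal.tsum_mul_right, θ.tsum_coe, one_mul]

variable {Ω F M : Type*} [Field F] [Fintype F] [AddCommGroup M] [Module F M] [Fintype M]

theorem log_card_div_log_card :
    Real.log (Fintype.card M) / Real.log (Fintype.card F) = Module.finrank F M := by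
  have log_pos : 0 < Real.log (Fintype.card F) :=
    Real.log_pos (Nat.one_lt_cast.2 Fintype.one_lt_card)
  rw [Module.card_eq_pow_finrank (K := F) (V := M), Nat.cast_pow, Real.log_pow,
    mul_div_cancel_right₀ _ log_pos.ne']

theorem entropy_le_finrank (p : PMF Ω) (X : Ω → M) :
    entropy (Fintype.card F) p X ≤ Module.finrank F M :=
  (entropy_le_log_card_div_log _ p X).trans_eq log_card_div_log_card

theorem entropy_eq_finrank_of_map_eq_uniform [Nonempty M] {p : PMF Ω} {X : Ω → M}
    (h : p.map X = PMF.uniformOfFintype M) :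
    entropy (Fintype.card F) p X = Module.finrank F M := by
  rw [entropy_eq_sum, ← log_card_div_log_card (F := F) (M := M)]
  have card_ne : (Fintype.card M : ℝ) ≠ 0 := Nat.cast_ne_zero.2 Fintype.card_ne_zero
  simp [prob, h, card_ne]

end Mixture

/-! ### The law of a scheme -/

namespace Scheme

variable {F : Type*} [Field F] [Fintype F] {n f β μ k : ℕ} {P : Scheme F n f β μ}
  {G : Matrix (Fin k) (Fin n) F} {V : Matrix (Fin μ) (Fin f) F}

theorem mem_support_law {v : Fin μ} {x : Messages F f β k × P.Queries} :
    x ∈ (P.law k v).support ↔ x.2 ∈ (P.queryLaw v).support := by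
  rw [PMF.mem_support_iff, PMF.mem_support_iff, law, bind_map_prodMk_apply,
    PMF.uniformOfFintype_apply]
  simp

theorem isRecoverable_iff :
    P.IsRecoverable G V ↔ ∀ v, Determines (P.law k v)
      (fun x : Messages F f β k × P.Queries => (P.reply G x, x.2)) fun x => linFun V x.1 v :=
  forall_congr' fun _ => condEntropy_eq_zero_iff Fintype.one_lt_card

theorem map_law (P : Scheme F n f β μ) (v : Fin μ) (j : Fin n) {γ : Type*}
    (Y : Messages F f β k × (Fin (P.querySize j) → F) → γ) :
    (P.law k v).map (fun x => Y (x.1, x.2 j)) =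
      ((PMF.uniformOfFintype (Messages F f β k)).bind fun w =>
        ((P.queryLaw v).map fun q => q j).map fun q => (w, q)).map Y := by
  rw [law, ← map_bind_map_prodMk, PMF.map_comp]
  rfl

theorem isPrivate_iff :
    P.IsPrivate G V ↔
      ∀ j v v', (P.queryLaw v).map (fun q => q j) = (P.queryLaw v').map (fun q => q j) := by
  have isPrivate_iff_law : P.IsPrivate G V ↔ ∀ (θ : PMF (Fin μ)) (j : Fin n),
      ∀ v ∈ θ.support, ∀ v' ∈ θ.support,
        (P.law k v).map (fun x => (x.2 j, P.reply G x j, linFun V x.1)) =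
          (P.law k v').map fun x => (x.2 j, P.reply G x j, linFun V x.1) :=
    forall₂_congr fun θ j => mutualInfo_bind_eq_zero_iff Fintype.one_lt_card θ (P.law k)
      fun x => (x.2 j, P.reply G x j, linFun V x.1)
  rw [isPrivate_iff_law]
  constructor
  · intro h j v v'
    have : Nonempty (Fin μ) := ⟨v⟩
    have map_query : ∀ v, ((P.law k v).map fun x => (x.2 j, P.reply G x j, linFun V x.1)).map
        Prod.fst = (P.queryLaw v).map fun q => q j := by
      intro v
      rw [PMF.map_comp, ← PMF.bind_const (PMF.uniformOfFintype (Messages F f β k)) (P.queryLaw v),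
        ← map_snd_bind_map_prodMk, PMF.map_comp]
      rfl
    rw [← map_query, ← map_query, h (PMF.uniformOfFintype _) j v
      (PMF.mem_support_uniformOfFintype v) v' (PMF.mem_support_uniformOfFintype v')]
  · intro h θ j v _ v' _
    let Y (x : Messages F f β k × (Fin (P.querySize j) → F)) :=
      (x.2, P.answer j x.2 (stored G x.1 j), linFun V x.1)
    exact (P.map_law v j Y).trans (by rw [h j v v', ← P.map_law v' j Y]; rfl)

theorem IsPrivate.map_law_eq (h : P.IsPrivate G V) (v v' : Fin μ) (j : Fin n) {γ : Type*}
    (Y : Messages F f β k × (Fin (P.querySize j) → F) → γ) :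
    (P.law k v).map (fun x => Y (x.1, x.2 j)) = (P.law k v').map (fun x => Y (x.1, x.2 j)) := by
  rw [map_law, map_law, isPrivate_iff.1 h j v v']

theorem entropy_law (P : Scheme F n f β μ) (v : Fin μ) :
    entropy (Fintype.card F) (P.law k v) (fun x => (x.1, x.2)) =
      f * (β * k) + entropy (Fintype.card F) (P.law k v) fun x => x.2 := by
  have indep : mutualInfo (Fintype.card F) (P.law k v) (fun x => x.1) (fun x => x.2) = 0 :=
    (mutualInfo_bind_eq_zero_iff Fintype.one_lt_card _ _ id).2 fun _ _ _ _ => rfl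
  have entropy_messages : entropy (Fintype.card F) (P.law k v) (fun x => x.1) = f * (β * k) := by
    rw [entropy_eq_finrank_of_map_eq_uniform (F := F)
      (show (P.law k v).map (fun x => x.1) = _ from map_fst_bind_map_prodMk _ _)]
    simp [Module.finrank_pi_fintype, Module.finrank_matrix]
  rw [mutualInfo] at indep
  linarith

end Scheme

/-! ### Information sets -/

section InformationSets

variable {F : Type*} [Field F] {k n ν κ : ℕ} {G : Matrix (Fin k) (Fin n) F}

theorem IsInformationSet.card_eq {I : Finset (Fin n)} (hI : IsInformationSet G I) : I.card = k := by
  obtain ⟨e, -⟩ := hI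
  simpa using (Fintype.card_congr e).symm

theorem IsInformationSet.eq_zero_of_sum_smul {I : Finset (Fin n)} (hI : IsInformationSet G I)
    {N : Type*} [AddCommGroup N] [Module F N] {a : Fin k → N}
    (h : ∀ j ∈ I, ∑ l, G l j • a l = 0) : a = 0 := by
  obtain ⟨e, he⟩ := hI
  set B := G.submatrix id fun i => (e i : Fin n)
  have mul_inv : B * B⁻¹ = 1 := B.mul_nonsing_inv (B.isUnit_iff_isUnit_det.1 he)
  funext l
  calc a l = ∑ l', (B * B⁻¹) l' l • a l' := by simp [mul_inv, Matrix.one_apply]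
    _ = ∑ i, B⁻¹ i l • ∑ l', B l' i • a l' := by
      simp_rw [Matrix.mul_apply, Finset.sum_smul, Finset.smul_sum, smul_smul]
      rw [Finset.sum_comm]
      simp_rw [mul_comm]
    _ = 0 := Finset.sum_eq_zero fun i _ => by
      rw [show ∑ l', B l' i • a l' = 0 from h (e i) (e i).2, smul_zero]

theorem stored_eq_sum {f β : ℕ} (G : Matrix (Fin k) (Fin n) F) (w : Messages F f β k) (j : Fin n) :
    stored G w j = ∑ l, G l j • fun m i => w m i l := by
  funext m i
  simp [stored, Matrix.mul_apply, Finset.sum_apply, mul_comm]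

theorem stored_linFun (G : Matrix (Fin k) (Fin n) F) {f β μ : ℕ}
    (V : Matrix (Fin μ) (Fin f) F) (w : Messages F f β k) (j : Fin n) (v : Fin μ) :
    ∑ m, V v m • stored G w j m = fun i => (linFun V w v * G) i j := by
  funext i
  simp [linFun, stored, Matrix.sum_mul, Matrix.sum_apply, Finset.sum_apply]

theorem IsInformationSet.eq_of_stored_eq {I : Finset (Fin n)} (hI : IsInformationSet G I)
    {f β : ℕ} {w w' : Messages F f β k} (h : ∀ j ∈ I, stored G w j = stored G w' j) : w = w' := by
  have sub_eq_zero : (fun l m i => w m i l - w' m i l : Fin k → Fin f → Fin β → F) = 0 := by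
    refine hI.eq_zero_of_sum_smul fun j hj => ?_
    have sum_eq := h j hj
    rw [stored_eq_sum, stored_eq_sum, ← _root_.sub_eq_zero, ← Finset.sum_sub_distrib] at sum_eq
    simp_rw [← smul_sub] at sum_eq
    exact sum_eq
  funext m i l
  exact _root_.sub_eq_zero.1 (congrFun₃ sub_eq_zero l m i)

/-- The `I u` are information sets of the code generated by `G`, and each coordinate lies in exactly
`κ` of them. These are the supports of the rows of a rate matrix with `κ / ν = k / n`. -/
structure IsUniformCover (G : Matrix (Fin k) (Fin n) F) (I : Fin ν → Finset (Fin n)) (κ : ℕ) :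
    Prop where
  isInformationSet : ∀ u, IsInformationSet G (I u)
  card_filter_mem : ∀ j, (Finset.univ.filter fun u => j ∈ I u).card = κ

namespace IsUniformCover

variable {I : Fin ν → Finset (Fin n)}

theorem sum_sum (hI : IsUniformCover G I κ) {M : Type*} [AddCommMonoid M] (g : Fin n → M) :
    ∑ u, ∑ j ∈ I u, g j = κ • ∑ j, g j := by
  rw [Finset.sum_comm' (t' := Finset.univ) (s' := fun j => Finset.univ.filter fun u => j ∈ I u)
    (by simp)]
  simp_rw [Finset.sum_const, hI.card_filter_mem, Finset.smul_sum]

theorem mul_eq (hI : IsUniformCover G I κ) : κ * n = k * ν := by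
  have sum_one := hI.sum_sum fun _ => 1
  simp only [Finset.sum_const, (hI.isInformationSet _).card_eq, Finset.card_univ, Fintype.card_fin,
    smul_eq_mul, mul_one] at sum_one
  rw [← sum_one, mul_comm]

theorem lt (hI : IsUniformCover G I κ) (hkn : k < n) (hν : 0 < ν) : κ < ν := by
  have : κ * n < ν * n := by
    rw [hI.mul_eq, mul_comm ν]
    exact Nat.mul_lt_mul_of_pos_right hkn hν
  exact lt_of_mul_lt_mul_right' this

end IsUniformCover

theorem IsMDSPIRCapacityAchieving.exists_isUniformCover (h : IsMDSPIRCapacityAchieving G)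
    (hn : 0 < n) :
    ∃ (κ ν : ℕ) (I : Fin ν → Finset (Fin n)), 0 < ν ∧ IsUniformCover G I κ := by
  obtain ⟨κ, ν, Λ, hν, ⟨card_col, exists_subset⟩, ratio_eq⟩ := h
  choose I hI subset_row using exists_subset
  have mul_eq : κ * n = k * ν := by
    rw [div_eq_div_iff (by positivity) (by positivity)] at ratio_eq
    exact_mod_cast ratio_eq
  have subset : ∀ u, I u ⊆ Finset.univ.filter fun j => Λ u j = true := fun u j hj => by
    simpa using subset_row u j hj
  have sum_card_eq : ∑ u, (I u).card = ∑ u, (Finset.univ.filter fun j => Λ u j = true).card := by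
    calc ∑ u, (I u).card = ∑ j, (Finset.univ.filter fun u => Λ u j = true).card := by
          simp [(hI _).card_eq, card_col, mul_comm ν, mul_comm n, mul_eq]
      _ = ∑ u, (Finset.univ.filter fun j => Λ u j = true).card := by
          simp_rw [Finset.card_filter]
          exact Finset.sum_comm
  have card_eq := (Finset.sum_eq_sum_iff_of_le fun u _ => Finset.card_le_card (subset u)).1
    sum_card_eq
  have I_eq : ∀ u, I u = Finset.univ.filter fun j => Λ u j = true := fun u =>
    Finset.eq_of_subset_of_card_le (subset u) (card_eq u (Finset.mem_univ u)).ge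
  exact ⟨κ, ν, I, hν, hI, fun j => by simpa [I_eq] using card_col j⟩

end InformationSets

/-! ### The converse -/

section Converse

theorem exists_linearIndepOn_row_card_eq_rank {K m n : Type*} [Field K] [Finite m] [Fintype n]
    (A : Matrix m n K) : ∃ T : Finset m, T.card = A.rank ∧ LinearIndepOn K A.row T := by
  obtain ⟨b, -, -, span_le, linIndep⟩ :=
    exists_linearIndepOn_extension (linearIndepOn_empty K A.row) (Set.empty_subset Set.univ)
  rw [Set.image_univ, ← Submodule.span_le] at span_le
  have span_eq := span_le.antisymm (Submodule.span_mono (Set.image_subset_range A.row b))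
  have := Fintype.ofFinite b
  refine ⟨b.toFinset, ?_, by rwa [Set.coe_toFinset]⟩
  rw [A.rank_eq_finrank_span_row, span_eq, Set.image_eq_range,
    finrank_span_eq_card (b := fun i : b => A.row i) linIndep, Set.toFinset_card]

variable {F : Type*} [Field F] [Fintype F]

theorem condEntropy_le_mul_finrank {Ω ι κ γ N : Type*} [Fintype ι] [DecidableEq ι] [Fintype γ]
    [AddCommGroup N] [Module F N] [Fintype N] {p : PMF Ω} {w : Ω → ι → N} {Z : Ω → γ}
    {c : κ → ι → F} {s : Finset κ} (hc : LinearIndepOn F c s)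
    (hZ : ∀ i ∈ s, Determines p Z fun ω => ∑ m, c i m • w ω m) :
    condEntropy (Fintype.card F) p w Z ≤ (Fintype.card ι - s.card) * Module.finrank F N := by
  set U := Submodule.span F (Set.range fun i : s => c i)
  obtain ⟨U', isCompl⟩ := U.exists_isCompl
  have finrank_add : s.card + Module.finrank F U' = Fintype.card ι := by
    rw [← Module.finrank_pi F, ← Submodule.finrank_add_eq_of_isCompl isCompl,
      finrank_span_eq_card (b := fun i : s => c i) hc, Fintype.card_coe]
  have : Finite (U' →ₗ[F] N) := Module.finite_of_finite F
  let _ := Fintype.ofFinite (U' →ₗ[F] N)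
  let T (ω : Ω) : U' →ₗ[F] N := (Fintype.linearCombination F (w ω)).domRestrict U'
  have determines : Determines p (fun ω => (T ω, Z ω)) w := by
    intro ω hω ω' hω' e
    have eqOn : Set.EqOn (Fintype.linearCombination F (w ω)) (Fintype.linearCombination F (w ω'))
        U := by
      refine LinearMap.eqOn_span ?_
      rintro _ ⟨i, rfl⟩
      exact hZ i i.2 ω hω ω' hω' (Prod.ext_iff.1 e).2
    have eqOn' : Set.EqOn (Fintype.linearCombination F (w ω)) (Fintype.linearCombination F (w ω'))
        U' := fun y hy => LinearMap.congr_fun (Prod.ext_iff.1 e).1 ⟨y, hy⟩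
    have eq := LinearMap.ext_on_codisjoint isCompl.codisjoint eqOn eqOn'
    funext m
    simpa using LinearMap.congr_fun eq (Pi.single m 1)
  calc condEntropy (Fintype.card F) p w Z ≤ entropy (Fintype.card F) p T :=
        determines.condEntropy_le_left.trans (condEntropy_le_entropy _ p T Z)
    _ ≤ Module.finrank F (U' →ₗ[F] N) := entropy_le_finrank p T
    _ = (Fintype.card ι - s.card) * Module.finrank F N := by
      rw [Module.finrank_linearMap, ← finrank_add]
      push_cast
      ring

variable {n k f μ β : ℕ} {G : Matrix (Fin k) (Fin n) F} {V : Matrix (Fin μ) (Fin f) F}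

namespace Scheme

/-- The information `H(A₁, …, Aₙ | X⁽ˢ⁾ (s ∈ S), Q₁, …, Qₙ)` of the answers that is left when the
functions in `S` are known and function `v` is requested. -/
noncomputable def residualEntropy (P : Scheme F n f β μ) (G : Matrix (Fin k) (Fin n) F)
    (V : Matrix (Fin μ) (Fin f) F) (v : Fin μ) (S : Finset (Fin μ)) : ℝ :=
  condEntropy (Fintype.card F) (P.law k v) (P.reply G) fun x => (S.restrict (linFun V x.1), x.2)

/-- The information `H(Aⱼ | X⁽ˢ⁾ (s ∈ S), Qⱼ)` of the answer of database `j` that is left when the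
functions in `S` are known and function `v` is requested. -/
noncomputable def residualEntropyAt (P : Scheme F n f β μ) (G : Matrix (Fin k) (Fin n) F)
    (V : Matrix (Fin μ) (Fin f) F) (v : Fin μ) (S : Finset (Fin μ)) (j : Fin n) : ℝ :=
  condEntropy (Fintype.card F) (P.law k v) (fun x => P.reply G x j)
    fun x => (S.restrict (linFun V x.1), x.2 j)

variable {P : Scheme F n f β μ}

theorem le_condEntropy_messages (P : Scheme F n f β μ) (V : Matrix (Fin μ) (Fin f) F) (v : Fin μ)
    (S : Finset (Fin μ)) :
    (f - S.card) * (β * k : ℝ) ≤ condEntropy (Fintype.card F) (P.law k v) (fun x => x.1)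
      fun x => (S.restrict (linFun V x.1), x.2) := by
  have entropy_messages : f * (β * k) + entropy (Fintype.card F) (P.law k v) (fun x => x.2) ≤
      entropy (Fintype.card F) (P.law k v) fun x => (x.1, S.restrict (linFun V x.1), x.2) :=
    (P.entropy_law v).symm.trans_le
      (Determines.entropy_le (.of_comp (fun t => (t.1, t.2.2)) fun _ => rfl))
  have entropy_functions : condEntropy (Fintype.card F) (P.law k v)
      (fun x => S.restrict (linFun V x.1)) (fun x => x.2) ≤ S.card * (β * k : ℝ) := by
    refine (condEntropy_le_entropy _ _ _ _).trans ((entropy_le_finrank _ _).trans_eq ?_)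
    simp [Module.finrank_pi_fintype, Module.finrank_matrix]
  rw [condEntropy] at entropy_functions ⊢
  linarith

theorem le_condEntropy_linFun (P : Scheme F n f β μ) {v : Fin μ} {S : Finset (Fin μ)} (hv : v ∉ S)
    (hS : LinearIndepOn F V.row (insert v S : Finset (Fin μ))) :
    β * k ≤ condEntropy (Fintype.card F) (P.law k v) (fun x => linFun V x.1 v)
      fun x => (S.restrict (linFun V x.1), x.2) := by
  have lower := (P.le_condEntropy_messages (k := k) V v S).trans <|
    Determines.condEntropy_le_left (X := fun x => (x.1, linFun V x.1 v))
      (.of_comp (fun t => t.1.1) fun _ => rfl)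
  have upper : condEntropy (Fintype.card F) (P.law k v) (fun x => x.1)
      (fun x => (linFun V x.1 v, S.restrict (linFun V x.1), x.2)) ≤
        (f - (S.card + 1)) * (β * k : ℝ) := by
    refine (condEntropy_le_mul_finrank hS fun i hi => ?_).trans_eq ?_
    · obtain rfl | hi := Finset.mem_insert.1 hi
      exacts [.of_comp (fun t => t.1) fun _ => rfl, .of_comp (fun t => t.2.1 ⟨i, hi⟩) fun _ => rfl]
    · simp [Finset.card_insert_of_notMem hv, Module.finrank_matrix]
  rw [condEntropy_prodMk] at lower
  linarith

theorem IsRecoverable.add_residualEntropy_insert_le (h : P.IsRecoverable G V) {v : Fin μ}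
    {S : Finset (Fin μ)} (hv : v ∉ S) (hS : LinearIndepOn F V.row (insert v S : Finset (Fin μ))) :
    β * k + P.residualEntropy G V v (insert v S) ≤ P.residualEntropy G V v S := by
  have decode : Determines (P.law k v)
      (fun x => (P.reply G x, S.restrict (linFun V x.1), x.2))
      fun x => (P.reply G x, linFun V x.1 v) := fun x hx x' hx' e => by
    simp only [Prod.mk.injEq] at e ⊢
    exact ⟨e.1, isRecoverable_iff.1 h v x hx x' hx' (Prod.ext e.1 e.2.2)⟩
  have split : Determines (P.law k v) (fun x => ((insert v S).restrict (linFun V x.1), x.2))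
      fun x => (linFun V x.1 v, S.restrict (linFun V x.1), x.2) :=
    .of_comp (fun t => (t.1 ⟨v, Finset.mem_insert_self v S⟩,
      (fun i : S => t.1 ⟨i, Finset.mem_insert_of_mem i.2⟩), t.2)) fun _ => rfl
  calc β * k + P.residualEntropy G V v (insert v S)
      ≤ condEntropy (Fintype.card F) (P.law k v) (fun x => linFun V x.1 v)
          (fun x => (S.restrict (linFun V x.1), x.2)) +
        condEntropy (Fintype.card F) (P.law k v) (P.reply G)
          (fun x => (linFun V x.1 v, S.restrict (linFun V x.1), x.2)) :=
        add_le_add (P.le_condEntropy_linFun hv hS) split.condEntropy_le_right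
    _ = condEntropy (Fintype.card F) (P.law k v) (fun x => (P.reply G x, linFun V x.1 v))
          (fun x => (S.restrict (linFun V x.1), x.2)) := by rw [condEntropy_prodMk, add_comm]
    _ ≤ P.residualEntropy G V v S := decode.condEntropy_le_left

theorem condEntropy_stored_add_residualEntropyAt_le (P : Scheme F n f β μ)
    (G : Matrix (Fin k) (Fin n) F) (v : Fin μ) {S : Finset (Fin μ)} (hS : LinearIndepOn F V.row S)
    (j : Fin n) :
    condEntropy (Fintype.card F) (P.law k v) (fun x => stored G x.1 j)
        (fun x => (P.reply G x j, S.restrict (linFun V x.1), x.2 j)) +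
      P.residualEntropyAt G V v S j ≤ (f - S.card) * β := by
  rw [residualEntropyAt, ← condEntropy_prodMk]
  calc condEntropy (Fintype.card F) (P.law k v) (fun x => (stored G x.1 j, P.reply G x j))
        (fun x => (S.restrict (linFun V x.1), x.2 j))
      ≤ condEntropy (Fintype.card F) (P.law k v) (fun x => stored G x.1 j)
        (fun x => (S.restrict (linFun V x.1), x.2 j)) :=
        Determines.condEntropy_le_left
          (.of_comp (fun t => (t.1, P.answer j t.2.2 t.1)) fun _ => rfl)
    _ ≤ (f - S.card) * β := by
      refine (condEntropy_le_mul_finrank hS fun i hi => ?_).trans_eq (by simp)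
      exact .of_comp (fun t i' => (t.1 ⟨i, hi⟩ * G) i' j) fun x => stored_linFun G V x.1 j i

-- Given the known functions, the contents of the databases in an information set are independent:
-- their entropies add up to that of the messages. Hence so are the answers of these databases.
theorem sum_residualEntropyAt_le (P : Scheme F n f β μ) (v : Fin μ) {S : Finset (Fin μ)}
    (hS : LinearIndepOn F V.row S) {I : Finset (Fin n)} (hI : IsInformationSet G I) :
    ∑ j ∈ I, P.residualEntropyAt G V v S j ≤ P.residualEntropy G V v S := by
  set p := P.law k v
  let contents (x : Messages F f β k × P.Queries) := I.restrict (stored G x.1)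
  let Z (x : Messages F f β k × P.Queries) := (S.restrict (linFun V x.1), x.2)
  have determines : Determines p (fun x => ((contents x, P.reply G x), Z x)) fun x => x.1 :=
    fun x _ x' _ e => hI.eq_of_stored_eq fun j hj =>
      congrFun (Prod.ext_iff.1 (Prod.ext_iff.1 e).1).1 ⟨j, hj⟩
  have condEntropy_contents : condEntropy (Fintype.card F) p contents (fun x => (P.reply G x, Z x))
      ≤ ∑ j ∈ I, ((f - S.card) * β - P.residualEntropyAt G V v S j) := by
    refine (condEntropy_restrict_le _ p (fun x => stored G x.1) _ I).trans
      (Finset.sum_le_sum fun j _ => ?_)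
    refine le_sub_iff_add_le.2 (le_trans (add_le_add_left ?_ _)
      (P.condEntropy_stored_add_residualEntropyAt_le G v hS j))
    exact Determines.condEntropy_le_right
      (.of_comp (fun t => (t.1 j, t.2.1, t.2.2 j)) fun _ => rfl)
  have condEntropy_messages := (P.le_condEntropy_messages V v S).trans
    (determines.condEntropy_le_left (b := Fintype.card F))
  rw [condEntropy_prodMk] at condEntropy_messages
  rw [Finset.sum_sub_distrib, Finset.sum_const, hI.card_eq, nsmul_eq_mul] at condEntropy_contents
  rw [residualEntropy]
  linarith

theorem residualEntropy_le_sum (P : Scheme F n f β μ) (G : Matrix (Fin k) (Fin n) F)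
    (V : Matrix (Fin μ) (Fin f) F) (v : Fin μ) (S : Finset (Fin μ)) :
    P.residualEntropy G V v S ≤ ∑ j, P.residualEntropyAt G V v S j := by
  calc P.residualEntropy G V v S
      ≤ condEntropy (Fintype.card F) (P.law k v) (fun x => Finset.univ.restrict (P.reply G x))
          fun x => (S.restrict (linFun V x.1), x.2) :=
        Determines.condEntropy_le_left
          (.of_comp (fun t j => t.1 ⟨j, Finset.mem_univ j⟩) fun _ => rfl)
    _ ≤ ∑ j, condEntropy (Fintype.card F) (P.law k v) (fun x => P.reply G x j)
          fun x => (S.restrict (linFun V x.1), x.2) :=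
        condEntropy_restrict_le _ _ _ _ _
    _ ≤ ∑ j, P.residualEntropyAt G V v S j := Finset.sum_le_sum fun j _ =>
        Determines.condEntropy_le_right (.of_comp (fun t => (t.1, t.2 j)) fun _ => rfl)

theorem IsPrivate.residualEntropyAt_eq (h : P.IsPrivate G V) (v v' : Fin μ) (S : Finset (Fin μ))
    (j : Fin n) : P.residualEntropyAt G V v S j = P.residualEntropyAt G V v' S j :=
  condEntropy_congr <| h.map_law_eq v v' j fun y =>
    (P.answer j y.2 (stored G y.1 j), S.restrict (linFun V y.1), y.2)

theorem IsPrivate.entropy_reply_eq (h : P.IsPrivate G V) (v v' : Fin μ) (j : Fin n) :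
    entropy (Fintype.card F) (P.law k v) (fun x => P.reply G x j) =
      entropy (Fintype.card F) (P.law k v') fun x => P.reply G x j :=
  entropy_congr <| h.map_law_eq v v' j fun y => P.answer j y.2 (stored G y.1 j)

theorem IsPrivate.div_mul_residualEntropy_le (h : P.IsPrivate G V) {κ ν : ℕ}
    {I : Fin ν → Finset (Fin n)} (hI : IsUniformCover G I κ) (hν : 0 < ν) (v v' : Fin μ)
    {S : Finset (Fin μ)} (hS : LinearIndepOn F V.row S) :
    (κ / ν : ℝ) * P.residualEntropy G V v' S ≤ P.residualEntropy G V v S := by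
  rw [div_mul_eq_mul_div, div_le_iff₀ (Nat.cast_pos.2 hν)]
  calc κ * P.residualEntropy G V v' S
      ≤ κ * ∑ j, P.residualEntropyAt G V v S j := by
        simp_rw [h.residualEntropyAt_eq v v' S]
        gcongr
        exact P.residualEntropy_le_sum G V v' S
    _ = ∑ u, ∑ j ∈ I u, P.residualEntropyAt G V v S j := by rw [hI.sum_sum, nsmul_eq_mul]
    _ ≤ ∑ _u : Fin ν, P.residualEntropy G V v S :=
        Finset.sum_le_sum fun u _ => P.sum_residualEntropyAt_le v hS (hI.isInformationSet u)
    _ = P.residualEntropy G V v S * ν := by simp [mul_comm]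

end Scheme

namespace Protocol

variable {κ ν : ℕ} {I : Fin ν → Finset (Fin n)}

theorem mul_sum_pow_le_residualEntropy (P : Protocol G V β) (hI : IsUniformCover G I κ)
    (hν : 0 < ν) {T S : Finset (Fin μ)} {v : Fin μ} (hvT : v ∉ T) (hS : Disjoint (insert v T) S)
    (hTS : LinearIndepOn F V.row (insert v T ∪ S : Finset (Fin μ))) :
    β * k * ∑ i ∈ Finset.range (T.card + 1), (κ / ν : ℝ) ^ i ≤ P.residualEntropy G V v S := by
  induction T using Finset.induction_on generalizing v S with
  | empty =>
    have decode := P.isRecoverable.add_residualEntropy_insert_le (S := S) (by simpa using hS)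
      (by simpa using hTS)
    have : 0 ≤ P.residualEntropy G V v (insert v S) := condEntropy_nonneg _ _ _ _
    simpa using le_trans (by simpa using this) decode
  | insert v' T hv'T ih =>
    have union_eq : insert v' T ∪ insert v S = insert v (insert v' T) ∪ S := by
      rw [Finset.union_insert, Finset.insert_union v]
    have linIndep : LinearIndepOn F V.row (insert v S : Finset (Fin μ)) :=
      hTS.mono <| Finset.coe_subset.2 <| union_eq ▸ Finset.subset_union_right
    have decode := P.isRecoverable.add_residualEntropy_insert_le
      (Finset.disjoint_left.1 hS (Finset.mem_insert_self v _)) linIndep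
    have interference := P.isPrivate.div_mul_residualEntropy_le hI hν v v' linIndep
    have disjoint : Disjoint (insert v' T) (insert v S) :=
      Finset.disjoint_insert_right.2 ⟨hvT, hS.mono_left (Finset.subset_insert v _)⟩
    calc β * k * ∑ i ∈ Finset.range ((insert v' T).card + 1), (κ / ν : ℝ) ^ i
        = β * k + (κ / ν : ℝ) * (β * k * ∑ i ∈ Finset.range (T.card + 1), (κ / ν : ℝ) ^ i) := by
          rw [Finset.card_insert_of_notMem hv'T, Finset.sum_range_succ']
          simp_rw [pow_succ, ← Finset.sum_mul]
          ring
      _ ≤ β * k + (κ / ν : ℝ) * P.residualEntropy G V v' (insert v S) := by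
          gcongr
          exact ih hv'T disjoint (union_eq ▸ hTS)
      _ ≤ β * k + P.residualEntropy G V v (insert v S) := by gcongr
      _ ≤ P.residualEntropy G V v S := decode

theorem mul_sum_pow_rank_le_sum_entropy (P : Protocol G V β) (hI : IsUniformCover G I κ)
    (hν : 0 < ν) (v : Fin μ) :
    β * k * ∑ i ∈ Finset.range V.rank, (κ / ν : ℝ) ^ i ≤
      ∑ j, entropy (Fintype.card F) (P.law k v) fun x => P.reply G x j := by
  obtain ⟨T, card_T, linIndep⟩ := exists_linearIndepOn_row_card_eq_rank V
  obtain ⟨v', le_residualEntropy⟩ : ∃ v', β * k * ∑ i ∈ Finset.range V.rank, (κ / ν : ℝ) ^ i ≤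
      P.residualEntropy G V v' ∅ := by
    obtain rfl | ⟨v', hv'⟩ := T.eq_empty_or_nonempty
    · exact ⟨v, by simpa [← card_T, Scheme.residualEntropy] using condEntropy_nonneg _ _ _ _⟩
    · refine ⟨v', ?_⟩
      rw [← card_T, ← Finset.card_erase_add_one hv']
      exact P.mul_sum_pow_le_residualEntropy hI hν (Finset.notMem_erase v' T)
        (Finset.disjoint_empty_right _) (by rwa [Finset.insert_erase hv', Finset.union_empty])
  refine le_residualEntropy.trans ((P.residualEntropy_le_sum G V v' ∅).trans
    (Finset.sum_le_sum fun j _ => ?_))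
  rw [P.isPrivate.entropy_reply_eq v v']
  exact condEntropy_le_entropy _ _ _ _

end Protocol

end Converse

/-! ### Alternating forms -/

section AlternatingForms

variable {R : Type*} [CommRing R] {M M' B N : Type*} [AddCommGroup M] [Module R M]
  [AddCommGroup M'] [Module R M'] [AddCommGroup B] [Module R B] [AddCommGroup N] [Module R N]

/-- Precomposition of alternating maps with a linear map, as a linear map. -/
def pullback (g : M' →ₗ[R] M) (i : ℕ) : (M [⋀^Fin i]→ₗ[R] N) →ₗ[R] (M' [⋀^Fin i]→ₗ[R] N) where
  toFun z := z.compLinearMap g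
  map_add' _ _ := rfl
  map_smul' _ _ := rfl

theorem pullback_apply (g : M' →ₗ[R] M) {i : ℕ} (z : M [⋀^Fin i]→ₗ[R] N) (v : Fin i → M') :
    pullback g i z v = z fun p => g (v p) := rfl

theorem pullback_alternatizeUncurryFin (g : M' →ₗ[R] M) {i : ℕ}
    (L : M →ₗ[R] M [⋀^Fin i]→ₗ[R] N) :
    pullback g (i + 1) (AlternatingMap.alternatizeUncurryFin L) =
      AlternatingMap.alternatizeUncurryFin (pullback g i ∘ₗ L ∘ₗ g) := by
  ext v
  rw [pullback_apply, AlternatingMap.alternatizeUncurryFin_apply,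
    AlternatingMap.alternatizeUncurryFin_apply]
  rfl

/-- Restriction to `B` of an alternating map on `R × B`. -/
abbrev restrict (i : ℕ) : ((R × B) [⋀^Fin i]→ₗ[R] N) →ₗ[R] (B [⋀^Fin i]→ₗ[R] N) :=
  pullback (LinearMap.inr R R B) i

/-- Contraction with `(1, 0)` of an alternating map on `R × B`, restricted to `B`. Together with
`restrict`, it splits an alternating map on `R × B` into two alternating maps on `B`. -/
def contract (i : ℕ) : ((R × B) [⋀^Fin (i + 1)]→ₗ[R] N) →ₗ[R] (B [⋀^Fin i]→ₗ[R] N) :=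
  restrict i ∘ₗ LinearMap.applyₗ ((1 : R), (0 : B)) ∘ₗ AlternatingMap.curryLeftLinearMap

theorem contract_apply {i : ℕ} (z : (R × B) [⋀^Fin (i + 1)]→ₗ[R] N) (v : Fin i → B) :
    contract i z v = z (Matrix.vecCons (1, 0) fun p => (0, v p)) := rfl

/-- The alternating map on `R × B` with given restriction `ψ` and contraction `ψ'`, namely
`ψ + dt ∧ ψ'`, where `dt` is the projection to `R`. -/
def assemble (i : ℕ) : ((B [⋀^Fin (i + 1)]→ₗ[R] N) × (B [⋀^Fin i]→ₗ[R] N)) →ₗ[R]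
    ((R × B) [⋀^Fin (i + 1)]→ₗ[R] N) :=
  (pullback (LinearMap.snd R R B) (i + 1)).coprod
    (AlternatingMap.alternatizeUncurryFinLM ∘ₗ LinearMap.smulRightₗ (LinearMap.fst R R B) ∘ₗ
      pullback (LinearMap.snd R R B) i)

theorem assemble_apply {i : ℕ} (ψ : B [⋀^Fin (i + 1)]→ₗ[R] N) (ψ' : B [⋀^Fin i]→ₗ[R] N)
    (v : Fin (i + 1) → R × B) :
    assemble i (ψ, ψ') v = ψ (fun p => (v p).2) +
      ∑ p : Fin (i + 1), (-1) ^ (p : ℕ) • ((v p).1 • ψ' fun q => (p.removeNth v q).2) := by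
  simp only [assemble, LinearMap.coprod_apply, LinearMap.comp_apply, AlternatingMap.add_apply,
    AlternatingMap.alternatizeUncurryFinLM_apply, AlternatingMap.alternatizeUncurryFin_apply]
  rfl

theorem restrict_zero_injective :
    Function.Injective (restrict 0 : ((R × B) [⋀^Fin 0]→ₗ[R] N) →ₗ[R] _) := by
  intro z z' h
  ext v
  rw [Subsingleton.elim v fun p => LinearMap.inr R R B (p.elim0)]
  exact AlternatingMap.congr_fun h Fin.elim0

theorem restrict_assemble {i : ℕ} (ψ : B [⋀^Fin (i + 1)]→ₗ[R] N) (ψ' : B [⋀^Fin i]→ₗ[R] N) :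
    restrict (i + 1) (assemble i (ψ, ψ')) = ψ := by
  ext v
  simp [pullback_apply, assemble_apply]

theorem contract_assemble {i : ℕ} (ψ : B [⋀^Fin (i + 1)]→ₗ[R] N) (ψ' : B [⋀^Fin i]→ₗ[R] N) :
    contract i (assemble i (ψ, ψ')) = ψ' := by
  ext v
  rw [contract_apply, assemble_apply, AlternatingMap.map_coord_zero ψ 0 (by simp),
    Fin.sum_univ_succ]
  simp only [Matrix.cons_val_succ, zero_smul, smul_zero, Finset.sum_const_zero, add_zero, zero_add]
  simp [Fin.removeNth]

theorem restrict_alternatizeUncurryFin {i : ℕ} (L : (R × B) →ₗ[R] (R × B) [⋀^Fin i]→ₗ[R] N) :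
    restrict (i + 1) (AlternatingMap.alternatizeUncurryFin L) =
      AlternatingMap.alternatizeUncurryFin (restrict i ∘ₗ L ∘ₗ LinearMap.inr R R B) :=
  pullback_alternatizeUncurryFin _ L

theorem contract_alternatizeUncurryFin_zero (L : (R × B) →ₗ[R] (R × B) [⋀^Fin 0]→ₗ[R] N) :
    contract 0 (AlternatingMap.alternatizeUncurryFin L) = restrict 0 (L (1, 0)) := by
  ext v
  rw [contract_apply, AlternatingMap.alternatizeUncurryFin_apply, pullback_apply, Fin.sum_univ_one]
  simp

theorem contract_alternatizeUncurryFin_succ {i : ℕ}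
    (L : (R × B) →ₗ[R] (R × B) [⋀^Fin (i + 1)]→ₗ[R] N) :
    contract (i + 1) (AlternatingMap.alternatizeUncurryFin L) = restrict (i + 1) (L (1, 0)) -
      AlternatingMap.alternatizeUncurryFin (contract i ∘ₗ L ∘ₗ LinearMap.inr R R B) := by
  ext v
  have removeNth_succ (p : Fin (i + 1)) :
      p.succ.removeNth (Matrix.vecCons ((1 : R), (0 : B)) fun q => ((0 : R), v q)) =
        Matrix.vecCons (1, 0) fun q => (0, p.removeNth v q) := by
    funext q
    refine Fin.cases ?_ (fun q => ?_) q <;> simp [Fin.removeNth]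
  rw [contract_apply, AlternatingMap.alternatizeUncurryFin_apply, AlternatingMap.sub_apply,
    pullback_apply, AlternatingMap.alternatizeUncurryFin_apply, Fin.sum_univ_succ, sub_eq_add_neg,
    ← Finset.sum_neg_distrib]
  congr 1
  · simp
  · refine Finset.sum_congr rfl fun p _ => ?_
    rw [removeNth_succ, Fin.val_succ, pow_succ]
    simp [contract_apply]

end AlternatingForms

section Finrank

variable (F B : Type*) [Field F] [AddCommGroup B] [Module F B] [Module.Finite F B] (i : ℕ)

instance finite_alternatingForms : Module.Finite F (B [⋀^Fin i]→ₗ[F] F) :=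
  Module.Finite.equiv (exteriorPower.alternatingMapLinearEquiv (N := F)).symm

theorem finrank_alternatingForms :
    Module.finrank F (B [⋀^Fin i]→ₗ[F] F) = (Module.finrank F B).choose i := by
  rw [(exteriorPower.alternatingMapLinearEquiv (N := F)).finrank_eq, ← exteriorPower.finrank_eq]
  exact Subspace.dual_finrank_eq

variable {F B i}

theorem restrict_prod_contract_injective : Function.Injective
    ((restrict (i + 1)).prod (contract i) : ((F × B) [⋀^Fin (i + 1)]→ₗ[F] F) →ₗ[F] _) := by
  rw [LinearMap.injective_iff_surjective_of_finrank_eq_finrank]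
  · exact fun ψ => ⟨assemble i ψ, Prod.ext (restrict_assemble _ _) (contract_assemble _ _)⟩
  · simp only [Module.finrank_prod, finrank_alternatingForms, Module.finrank_self]
    rw [add_comm 1, Nat.choose_succ_succ, add_comm]

end Finrank

/-! ### Linear isomorphisms -/

section LinearEquiv

variable {F V W : Type*} [Field F] [AddCommGroup V] [Module F V]
  [AddCommGroup W] [Module F W]

theorem exists_linearEquiv_prod_ker {T : V →ₗ[F] W} (hT : Function.Surjective T) :
    ∃ e : V ≃ₗ[F] W × LinearMap.ker T, ∀ x, (e x).1 = T x := by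
  obtain ⟨C, hC⟩ := (LinearMap.ker T).exists_isCompl
  refine ⟨T.equivProdOfSurjectiveOfIsCompl ((LinearMap.ker T).projectionOnto C hC)
    (LinearMap.range_eq_top.2 hT) ?_ ?_, fun _ => rfl⟩
  · simp
  · simpa using hC

theorem exists_linearEquiv_comp_eq [Module.Finite F V] {T T' : V →ₗ[F] W}
    (hT : Function.Surjective T) (hT' : Function.Surjective T') :
    ∃ h : V ≃ₗ[F] V, ∀ x, T (h x) = T' x := by
  obtain ⟨e, he⟩ := exists_linearEquiv_prod_ker hT
  obtain ⟨e', he'⟩ := exists_linearEquiv_prod_ker hT'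
  have finrank_ker_eq :
      Module.finrank F (LinearMap.ker T') = Module.finrank F (LinearMap.ker T) := by
    have := T.finrank_range_add_finrank_ker
    have := T'.finrank_range_add_finrank_ker
    rw [LinearMap.range_eq_top.2 hT, LinearMap.range_eq_top.2 hT'] at *
    omega
  refine ⟨e' ≪≫ₗ (LinearEquiv.refl F W).prodCongr (.ofFinrankEq _ _ finrank_ker_eq) ≪≫ₗ e.symm,
    fun x => ?_⟩
  rw [← he, ← he']
  simp

theorem exists_linearEquiv_apply_eq [Module.Finite F V] [Module.Finite F W]
    (finrank_eq : Module.finrank F V = Module.finrank F W) {x : V} {y : W} (hx : x ≠ 0)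
    (hy : y ≠ 0) : ∃ e : V ≃ₗ[F] W, e x = y := by
  let e := LinearEquiv.ofFinrankEq V W finrank_eq
  have he : e x ≠ 0 := e.map_ne_zero_iff.2 hx
  obtain ⟨g, hg⟩ := Submodule.exists_linearEquiv_restrict_eq
    (LinearEquiv.coord F W (e x) he ≪≫ₗ LinearEquiv.toSpanNonzeroSingleton F W y hy)
  refine ⟨e ≪≫ₗ g, ?_⟩
  rw [LinearEquiv.trans_apply, ← hg ⟨e x, Submodule.mem_span_singleton_self _⟩]
  simp [LinearEquiv.coord_self]

end LinearEquiv

/-! ### Shares of a family of alternating forms -/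

section Shares

variable {F : Type*} [Field F] {B : Type*} [AddCommGroup B] [Module F B] {n k d ν : ℕ}
  {I : Fin ν → Finset (Fin n)} {c : ℕ → ℕ}

/-- Families of alternating forms on `B` of degrees `0, …, d`, with `c i` forms of degree `i` for
each of the `ν` information sets. The random encodings of the message columns take values here. -/
abbrev Blocks (F B : Type*) [Field F] [AddCommGroup B] [Module F B] (d ν : ℕ) (c : ℕ → ℕ) :
    Type _ :=
  ∀ i : Fin (d + 1), Fin ν × Fin (c i) → (B [⋀^Fin i]→ₗ[F] F)

/-- Families of alternating forms on `E` of degrees `0, …, d`, with `c i` forms of degree `i` for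
each information set containing `j`. The query to database `j` takes values here. -/
abbrev Shares (F E : Type*) [Field F] [AddCommGroup E] [Module F E] (d : ℕ) {ν n : ℕ}
    (I : Fin ν → Finset (Fin n)) (c : ℕ → ℕ) (j : Fin n) : Type _ :=
  ∀ i : Fin (d + 1), {u // j ∈ I u} × Fin (c i) → (E [⋀^Fin i]→ₗ[F] F)

/-- Same as `Shares`, with all degrees raised by one. The answer of database `j` lies here. -/
abbrev Responses (F E : Type*) [Field F] [AddCommGroup E] [Module F E] (d : ℕ) {ν n : ℕ}
    (I : Fin ν → Finset (Fin n)) (c : ℕ → ℕ) (j : Fin n) : Type _ :=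
  ∀ i : Fin (d + 1), {u // j ∈ I u} × Fin (c i) → (E [⋀^Fin (i + 1)]→ₗ[F] F)

/-- Bijections, at every coordinate `j`, between the blocks of degree `i + 1` of the information
sets containing `j` and the blocks of degree `i` of the other information sets. -/
abbrev Pairings (d : ℕ) {ν n : ℕ} (I : Fin ν → Finset (Fin n)) (c : ℕ → ℕ) : Type :=
  ∀ (j : Fin n) (i : ℕ), i < d →
    ({u // j ∈ I u} × Fin (c (i + 1)) ≃ {u // j ∉ I u} × Fin (c i))

/-- The block with index `p` in degree `i`, as a linear map. -/
def block (i : Fin (d + 1)) (p : Fin ν × Fin (c i)) :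
    Blocks F B d ν c →ₗ[F] (B [⋀^Fin i]→ₗ[F] F) :=
  LinearMap.proj p ∘ₗ LinearMap.proj i

/-- The forms on `F × B` attached to database `j`: the restrictions to `B` are the blocks of the
information sets containing `j`, and the contractions are the blocks of the others. -/
def share (σ : Pairings d I c) (j : Fin n) : ∀ (i : Fin (d + 1)) (_ : {u // j ∈ I u} × Fin (c i)),
    Blocks F B d ν c →ₗ[F] ((F × B) [⋀^Fin i]→ₗ[F] F)
  | ⟨0, h⟩, x => pullback (LinearMap.snd F F B) 0 ∘ₗ block ⟨0, h⟩ (x.1, x.2)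
  | ⟨i + 1, h⟩, x =>
    let y := σ j i (Nat.lt_of_succ_lt_succ h) x
    assemble i ∘ₗ (block ⟨i + 1, h⟩ (x.1, x.2)).prod (block ⟨i, Nat.lt_of_succ_lt h⟩ (y.1, y.2))

theorem restrict_comp_share (σ : Pairings d I c) (j : Fin n) (i : Fin (d + 1))
    (x : {u // j ∈ I u} × Fin (c i)) :
    restrict i ∘ₗ share (B := B) (F := F) σ j i x = block i (x.1, x.2) := by
  obtain ⟨_ | i, h⟩ := i
  · rfl
  · exact LinearMap.ext fun _ => restrict_assemble (R := F) (N := F) _ _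

theorem contract_comp_share (σ : Pairings d I c) (j : Fin n) {i : ℕ} (hi : i < d)
    (x : {u // j ∈ I u} × Fin (c (i + 1))) :
    contract i ∘ₗ share (B := B) (F := F) σ j ⟨i + 1, Nat.succ_lt_succ hi⟩ x =
      block ⟨i, Nat.lt_succ_of_lt hi⟩ ((σ j i hi x).1, (σ j i hi x).2) :=
  LinearMap.ext fun _ => contract_assemble (R := F) (N := F) _ _

theorem exists_share_eq [Module.Finite F B] (σ : Pairings d I c) (j : Fin n)
    (χ : Shares F (F × B) d I c j) :
    ∃ ψ : Blocks F B d ν c, ∀ i x, share σ j i x ψ = χ i x := by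
  classical
  let ψ : Blocks F B d ν c := fun i y =>
    if h : j ∈ I y.1 then restrict i (χ i (⟨y.1, h⟩, y.2))
    else if hi : (i : ℕ) < d then
      contract i (χ ⟨i + 1, Nat.succ_lt_succ hi⟩ ((σ j i hi).symm (⟨y.1, h⟩, y.2)))
    else 0
  refine ⟨ψ, fun i x => ?_⟩
  have restrict_eq : restrict i (share σ j i x ψ) = restrict i (χ i x) :=
    (LinearMap.congr_fun (restrict_comp_share σ j i x) ψ).trans (dif_pos x.1.2)
  obtain ⟨_ | i, h⟩ := i
  · exact restrict_zero_injective restrict_eq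
  · refine restrict_prod_contract_injective (Prod.ext restrict_eq ?_)
    have hi : i < d := Nat.lt_of_succ_lt_succ h
    refine (LinearMap.congr_fun (contract_comp_share σ j hi x) ψ).trans ?_
    simp [block, ψ, dif_neg (σ j i hi x).1.2, hi]

/-- The alternation of the block with index `p` in degree `i` of a linear family of blocks
parametrised by `F × B`, restricted to `B`. -/
def blockAlternation (i : Fin (d + 1)) (p : Fin ν × Fin (c i)) :
    ((F × B) →ₗ[F] Blocks F B d ν c) →ₗ[F] (B [⋀^Fin (i + 1)]→ₗ[F] F) :=
  AlternatingMap.alternatizeUncurryFinLM ∘ₗ LinearMap.compRight F (block i p) ∘ₗ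
    LinearMap.lcomp F _ (LinearMap.inr F F B)

theorem restrict_alternatizeUncurryFin_share (σ : Pairings d I c) (j : Fin n) (i : Fin (d + 1))
    (x : {u // j ∈ I u} × Fin (c i)) (L : (F × B) →ₗ[F] Blocks F B d ν c) :
    restrict (i + 1) (AlternatingMap.alternatizeUncurryFin (share σ j i x ∘ₗ L)) =
      blockAlternation i (x.1, x.2) L := by
  rw [restrict_alternatizeUncurryFin, LinearMap.comp_assoc, ← LinearMap.comp_assoc _ _ (restrict i),
    restrict_comp_share]
  rfl

theorem contract_alternatizeUncurryFin_share_zero (σ : Pairings d I c) (j : Fin n)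
    (x : {u // j ∈ I u} × Fin (c 0)) (L : (F × B) →ₗ[F] Blocks F B d ν c) :
    contract 0 (AlternatingMap.alternatizeUncurryFin (share σ j ⟨0, Nat.succ_pos d⟩ x ∘ₗ L)) =
      block ⟨0, Nat.succ_pos d⟩ (x.1, x.2) (L (1, 0)) :=
  (contract_alternatizeUncurryFin_zero _).trans
    (LinearMap.congr_fun (restrict_comp_share σ j ⟨0, Nat.succ_pos d⟩ x) _)

theorem contract_alternatizeUncurryFin_share_succ (σ : Pairings d I c) (j : Fin n) {i : ℕ}
    (hi : i < d) (x : {u // j ∈ I u} × Fin (c (i + 1))) (L : (F × B) →ₗ[F] Blocks F B d ν c) :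
    contract (i + 1) (AlternatingMap.alternatizeUncurryFin
        (share σ j ⟨i + 1, Nat.succ_lt_succ hi⟩ x ∘ₗ L)) =
      block ⟨i + 1, Nat.succ_lt_succ hi⟩ (x.1, x.2) (L (1, 0)) -
        blockAlternation ⟨i, Nat.lt_succ_of_lt hi⟩ ((σ j i hi x).1, (σ j i hi x).2) L := by
  refine (contract_alternatizeUncurryFin_succ _).trans (congrArg₂ _ ?_ ?_)
  · exact LinearMap.congr_fun (restrict_comp_share σ j ⟨i + 1, Nat.succ_lt_succ hi⟩ x) _
  · rw [LinearMap.comp_assoc, ← LinearMap.comp_assoc _ _ (contract i), contract_comp_share]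
    rfl

variable {G : Matrix (Fin k) (Fin n) F} {y : Fin k → (F × B) →ₗ[F] Blocks F B d ν c}

theorem blockAlternation_eq_zero (hI : ∀ u, IsInformationSet G (I u)) (σ : Pairings d I c)
    (h : ∀ j i x, AlternatingMap.alternatizeUncurryFin
      (share σ j i x ∘ₗ ∑ l, G l j • y l) = 0) (i : Fin (d + 1)) (p : Fin ν × Fin (c i))
    (l : Fin k) : blockAlternation i p (y l) = 0 := by
  refine congrFun ((hI p.1).eq_zero_of_sum_smul
    (a := fun l => blockAlternation i p (y l)) fun j hj => ?_) l
  simp_rw [← map_smul]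
  rw [← map_sum, ← restrict_alternatizeUncurryFin_share σ j i (⟨p.1, hj⟩, p.2), h, map_zero]

theorem eq_zero_of_alternatizeUncurryFin_share_eq_zero (hI : ∀ u, IsInformationSet G (I u))
    (σ : Pairings d I c)
    (h : ∀ j i x, AlternatingMap.alternatizeUncurryFin
      (share σ j i x ∘ₗ ∑ l, G l j • y l) = 0) (l : Fin k) :
    y l (1, 0) = 0 := by
  funext i p
  refine congrFun ((hI p.1).eq_zero_of_sum_smul
    (a := fun l => block i p (y l (1, 0))) fun j hj => ?_) l
  have sum_eq : ∑ l, G l j • block i p (y l (1, 0)) = block i p ((∑ l, G l j • y l) (1, 0)) := by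
    simp [LinearMap.sum_apply, map_sum]
  rw [sum_eq]
  obtain ⟨_ | i, hi⟩ := i
  · have contract_eq := contract_alternatizeUncurryFin_share_zero σ j (⟨p.1, hj⟩, p.2)
      (∑ l, G l j • y l)
    rw [h, map_zero] at contract_eq
    exact contract_eq.symm
  · have contract_eq := contract_alternatizeUncurryFin_share_succ σ j (Nat.lt_of_succ_lt_succ hi)
      (⟨p.1, hj⟩, p.2) (∑ l, G l j • y l)
    simp_rw [h, map_zero, map_sum, map_smul, blockAlternation_eq_zero hI σ h, smul_zero,
      Finset.sum_const_zero, sub_zero] at contract_eq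
    exact contract_eq.symm

end Shares

/-! ### The scheme -/

section Construction

variable {F : Type*} [Field F] {B E M : Type*} [AddCommGroup B] [Module F B] [AddCommGroup E]
  [Module F E] [AddCommGroup M] [Module F M] {n k d ν f β μ : ℕ} {I : Fin ν → Finset (Fin n)}
  {c : ℕ → ℕ}

/-- All shares of database `j`, transported along an isomorphism `F × B ≃ E`. -/
def shareMap (σ : Pairings d I c) (η : (F × B) ≃ₗ[F] E) (j : Fin n) :
    Blocks F B d ν c →ₗ[F] Shares F E d I c j :=
  LinearMap.pi fun i => LinearMap.pi fun x =>
    (AlternatingMap.domLCongr F F (Fin i) F η).toLinearMap ∘ₗ share σ j i x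

theorem shareMap_surjective [Module.Finite F B] (σ : Pairings d I c) (η : (F × B) ≃ₗ[F] E)
    (j : Fin n) : Function.Surjective (shareMap σ η j) := by
  intro χ
  obtain ⟨ψ, hψ⟩ := exists_share_eq σ j fun i x =>
    (AlternatingMap.domLCongr F F (Fin i) F η).symm (χ i x)
  exact ⟨ψ, funext₂ fun i x => (LinearEquiv.eq_symm_apply _).1 (hψ i x)⟩

/-- The answer of database `j` to the query `A`, as a function of its content `y`. A vector `e` of
the space `E` of requestable functions selects the combination `∑ₘ ι(e)ₘ yₘ` of the content, hence
`A` becomes a linear family of forms on `E` parametrised by `E`; the answer is its alternation. -/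
def respond (ι : E →ₗ[F] Fin f → F) (j : Fin n) (A : M →ₗ[F] Shares F E d I c j) :
    (Fin f → M) →ₗ[F] Responses F E d I c j :=
  LinearMap.pi fun i => LinearMap.pi fun x =>
    AlternatingMap.alternatizeUncurryFinLM ∘ₗ
      LinearMap.compRight F (LinearMap.proj x ∘ₗ LinearMap.proj i ∘ₗ A) ∘ₗ
        LinearMap.lcomp F M ι ∘ₗ Fintype.bilinearCombination F F

theorem pullback_respond_shareMap (σ : Pairings d I c) (ι : E →ₗ[F] Fin f → F)
    (η : (F × B) ≃ₗ[F] E) (j : Fin n) (Ψ : M →ₗ[F] Blocks F B d ν c) (y : Fin f → M)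
    (i : Fin (d + 1)) (x : {u // j ∈ I u} × Fin (c i)) :
    pullback η.toLinearMap (i + 1) (respond ι j (shareMap σ η j ∘ₗ Ψ) y i x) =
      AlternatingMap.alternatizeUncurryFin (share σ j i x ∘ₗ
        Ψ ∘ₗ Fintype.bilinearCombination F F y ∘ₗ ι ∘ₗ η.toLinearMap) := by
  refine (pullback_alternatizeUncurryFin _ _).trans (congrArg _ (LinearMap.ext fun e => ?_))
  exact (AlternatingMap.domLCongr F F (Fin i) F η).symm_apply_apply _

theorem linearCombination_eq_zero_of_respond_eq_zero {G : Matrix (Fin k) (Fin n) F}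
    (hI : ∀ u, IsInformationSet G (I u)) (σ : Pairings d I c) (ι : E →ₗ[F] Fin f → F)
    (η : (F × B) ≃ₗ[F] E) (Ψ : M ≃ₗ[F] Blocks F B d ν c) {a : Fin k → Fin f → M}
    (h : ∀ j, respond ι j (shareMap σ η j ∘ₗ Ψ.toLinearMap) (∑ l, G l j • a l) = 0) (l : Fin k) :
    Fintype.linearCombination F (a l) (ι (η (1, 0))) = 0 := by
  let y (l : Fin k) : (F × B) →ₗ[F] Blocks F B d ν c :=
    Ψ.toLinearMap ∘ₗ Fintype.bilinearCombination F F (a l) ∘ₗ ι ∘ₗ η.toLinearMap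
  refine Ψ.map_eq_zero_iff.1
    (eq_zero_of_alternatizeUncurryFin_share_eq_zero (y := y) hI σ (fun j i x => ?_) l)
  have sum_eq : ∑ l, G l j • y l = Ψ.toLinearMap ∘ₗ
      Fintype.bilinearCombination F F (∑ l, G l j • a l) ∘ₗ ι ∘ₗ η.toLinearMap := by
    refine LinearMap.ext fun e => ?_
    simp [y, LinearMap.sum_apply, map_sum]
  rw [sum_eq, ← pullback_respond_shareMap, h]
  exact map_zero _

variable [Module.Finite F E]

/-- The scheme in which the user maps the message columns to blocks by a uniformly random
isomorphism, sends each database its shares, and the databases answer with alternations. For the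
request `v`, the isomorphism `η v` decides which function `η v (1, 0)` can be decoded. -/
noncomputable def alternatingScheme (σ : Pairings d I c) (ι : E →ₗ[F] Fin f → F)
    (η : Fin μ → ((F × B) ≃ₗ[F] E)) [Fintype ((Fin β → F) ≃ₗ[F] Blocks F B d ν c)]
    [Nonempty ((Fin β → F) ≃ₗ[F] Blocks F B d ν c)] : Scheme F n f β μ where
  querySize j := Module.finrank F ((Fin β → F) →ₗ[F] Shares F E d I c j)
  answerSize j := Module.finrank F (Responses F E d I c j)
  queryLaw v := (PMF.uniformOfFintype ((Fin β → F) ≃ₗ[F] Blocks F B d ν c)).map fun Ψ j =>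
    (Module.finBasis F _).equivFun (shareMap σ (η v) j ∘ₗ Ψ.toLinearMap)
  answer j q y := (Module.finBasis F _).equivFun
    (respond ι j ((Module.finBasis F _).equivFun.symm q) y)

variable [Fintype F] [Fintype ((Fin β → F) ≃ₗ[F] Blocks F B d ν c)]
  [Nonempty ((Fin β → F) ≃ₗ[F] Blocks F B d ν c)]

theorem alternatingScheme_isPrivate [Module.Finite F B] (σ : Pairings d I c)
    (ι : E →ₗ[F] Fin f → F) (η : Fin μ → ((F × B) ≃ₗ[F] E)) (G : Matrix (Fin k) (Fin n) F)
    (V : Matrix (Fin μ) (Fin f) F) : (alternatingScheme (β := β) σ ι η).IsPrivate G V := by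
  refine Scheme.isPrivate_iff.2 fun j v v' => ?_
  obtain ⟨h, hh⟩ := exists_linearEquiv_comp_eq (shareMap_surjective σ (η v') j)
    (shareMap_surjective σ (η v) j)
  let e : Equiv.Perm ((Fin β → F) ≃ₗ[F] Blocks F B d ν c) :=
    { toFun := fun Ψ => Ψ ≪≫ₗ h
      invFun := fun Ψ => Ψ ≪≫ₗ h.symm
      left_inv := fun Ψ => by ext1; simp
      right_inv := fun Ψ => by ext1; simp }
  simp only [alternatingScheme, PMF.map_comp]
  conv_rhs => rw [← map_equiv_uniformOfFintype e, PMF.map_comp]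
  refine congrArg (PMF.map · _) (funext fun Ψ => congrArg (Module.finBasis F _).equivFun ?_)
  exact LinearMap.ext fun x => (hh _).symm

theorem alternatingScheme_isRecoverable {G : Matrix (Fin k) (Fin n) F}
    (hI : ∀ u, IsInformationSet G (I u)) (σ : Pairings d I c) (ι : E →ₗ[F] Fin f → F)
    (η : Fin μ → ((F × B) ≃ₗ[F] E)) {V : Matrix (Fin μ) (Fin f) F}
    (hη : ∀ v, V v ≠ 0 → ι (η v (1, 0)) = V v) :
    (alternatingScheme (β := β) σ ι η).IsRecoverable G V := by
  refine Scheme.isRecoverable_iff.2 fun v => ?_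
  rintro ⟨w, q⟩ hq ⟨w', q'⟩ - reply_eq
  obtain ⟨reply_eq, rfl : q = q'⟩ := Prod.mk.inj reply_eq
  obtain ⟨Ψ, -, rfl⟩ := (PMF.mem_support_map_iff _ _ _).1 (Scheme.mem_support_law.1 hq)
  by_cases hv : V v = 0
  · simp [linFun, hv]
  let a (l : Fin k) : Fin f → Fin β → F := (fun m i => w m i l) - fun m i => w' m i l
  have respond_eq_zero (j : Fin n) :
      respond ι j (shareMap σ (η v) j ∘ₗ Ψ.toLinearMap) (∑ l, G l j • a l) = 0 := by
    have stored_sub : ∑ l, G l j • a l = stored G w j - stored G w' j := by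
      simp only [a, stored_eq_sum, smul_sub, Finset.sum_sub_distrib]
    rw [stored_sub, map_sub, sub_eq_zero]
    simpa using (Module.finBasis F (Responses F E d I c j)).equivFun.injective (congrFun reply_eq j)
  ext i l
  have combination_eq_zero := congrFun
    (linearCombination_eq_zero_of_respond_eq_zero hI σ ι (η v) Ψ respond_eq_zero l) i
  simpa [hη v hv, a, Fintype.linearCombination_apply, linFun, Matrix.sum_apply, Finset.sum_apply,
    mul_sub, sub_eq_zero] using combination_eq_zero

end Construction

/-! ### Counting symbols -/

section Counting

variable {F : Type*} [Field F] {n k d ν κ : ℕ} {G : Matrix (Fin k) (Fin n) F}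
  {I : Fin ν → Finset (Fin n)}

/-- The number of forms of degree `i` for each information set. The ratio `δ / κ` of consecutive
values makes `Pairings` exist, and `κ ^ d` makes all values integers. -/
def blockCount (d κ δ i : ℕ) : ℕ := κ ^ (d - i) * δ ^ i

theorem finrank_blocks (hκν : κ ≤ ν) :
    Module.finrank F (Blocks F (Fin d → F) d ν (blockCount d κ (ν - κ))) = ν ^ (d + 1) := by
  simp_rw [Module.finrank_pi_fintype, finrank_alternatingForms, Module.finrank_fin_fun,
    Finset.sum_const, Finset.card_univ, Fintype.card_prod, Fintype.card_fin, smul_eq_mul]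
  rw [Fin.sum_univ_eq_sum_range (fun i => ν * blockCount d κ (ν - κ) i * d.choose i) (d + 1)]
  have binomial := add_pow (ν - κ) κ d
  rw [Nat.sub_add_cancel hκν] at binomial
  rw [pow_succ', binomial, Finset.mul_sum]
  refine Finset.sum_congr rfl fun i _ => ?_
  simp only [blockCount, Nat.cast_id]
  ring

namespace IsUniformCover

theorem card_subtype_mem (hI : IsUniformCover G I κ) (j : Fin n) :
    Fintype.card {u // j ∈ I u} = κ := by
  rw [Fintype.card_subtype, hI.card_filter_mem]

theorem nonempty_pairings (hI : IsUniformCover G I κ) :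
    Nonempty (Pairings d I (blockCount d κ (ν - κ))) := by
  refine ⟨fun j i hi => Fintype.equivOfCardEq ?_⟩
  rw [Fintype.card_prod, Fintype.card_prod, Fintype.card_subtype_compl, hI.card_subtype_mem,
    Fintype.card_fin, Fintype.card_fin, Fintype.card_fin, blockCount, blockCount]
  obtain ⟨e, rfl⟩ := Nat.exists_eq_add_of_lt hi
  rw [Nat.add_sub_add_right, Nat.add_assoc, Nat.add_sub_cancel_left, Nat.add_sub_cancel_left]
  ring

theorem mul_finrank_responses (hI : IsUniformCover G I κ) (hκν : κ ≤ ν) {E : Type*}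
    [AddCommGroup E] [Module F E] [Module.Finite F E] (finrank_eq : Module.finrank F E = d + 1)
    (j : Fin n) :
    (ν - κ) * Module.finrank F (Responses F E d I (blockCount d κ (ν - κ)) j) +
      κ * κ ^ (d + 1) = κ * ν ^ (d + 1) := by
  simp_rw [Module.finrank_pi_fintype, finrank_alternatingForms, finrank_eq, Finset.sum_const,
    Finset.card_univ, Fintype.card_prod, hI.card_subtype_mem, Fintype.card_fin, smul_eq_mul]
  rw [Fin.sum_univ_eq_sum_range
    (fun i => κ * blockCount d κ (ν - κ) i * (d + 1).choose (i + 1)) (d + 1)]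
  have binomial := add_pow (ν - κ) κ (d + 1)
  rw [Nat.sub_add_cancel hκν, Finset.sum_range_succ'] at binomial
  rw [binomial, mul_add, Finset.mul_sum, Finset.mul_sum]
  refine congrArg₂ _ (Finset.sum_congr rfl fun i _ => ?_) (by simp)
  simp only [blockCount, Nat.add_sub_add_right, Nat.cast_id]
  ring

theorem sum_finrank_responses (hI : IsUniformCover G I κ) (hκν : κ < ν) {E : Type*}
    [AddCommGroup E] [Module F E] [Module.Finite F E] (finrank_eq : Module.finrank F E = d + 1) :
    ∑ j, (Module.finrank F (Responses F E d I (blockCount d κ (ν - κ)) j) : ℝ) =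
      ν ^ (d + 1) * k * ∑ i ∈ Finset.range (d + 1), (κ / ν : ℝ) ^ i := by
  have hν : (ν : ℝ) ≠ 0 := Nat.cast_ne_zero.2 (Nat.ne_zero_of_lt hκν)
  have sub_ne : (κ : ℝ) - ν ≠ 0 := sub_ne_zero.2 (Nat.cast_injective.ne hκν.ne)
  have finrank_responses (j : Fin n) :
      (Module.finrank F (Responses F E d I (blockCount d κ (ν - κ)) j) : ℝ) =
        κ * ((κ ^ (d + 1) - ν ^ (d + 1)) / (κ - ν)) := by
    have mul_finrank := congrArg (Nat.cast (R := ℝ)) (hI.mul_finrank_responses hκν.le finrank_eq j)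
    push_cast [hκν.le] at mul_finrank
    rw [mul_div_assoc', eq_div_iff sub_ne]
    linarith
  have sum_pow : (ν ^ (d + 1) : ℝ) * ∑ i ∈ Finset.range (d + 1), (κ / ν : ℝ) ^ i =
      ν * ((κ ^ (d + 1) - ν ^ (d + 1)) / (κ - ν)) := by
    rw [geom_sum_eq fun h => sub_ne (sub_eq_zero.2 ((div_eq_one_iff_eq hν).1 h)), div_pow]
    field_simp
  have mul_eq : (κ : ℝ) * n = k * ν := mod_cast hI.mul_eq
  simp_rw [finrank_responses, Finset.sum_const, Finset.card_univ, Fintype.card_fin, nsmul_eq_mul]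
  rw [mul_right_comm, sum_pow, mul_right_comm, mul_comm (ν : ℝ) k, ← mul_eq]
  ring

end IsUniformCover

end Counting

/-! ### The capacity -/

section Capacity

variable {F : Type*} [Field F] {n k f μ β κ ν : ℕ} {G : Matrix (Fin k) (Fin n) F}
  {V : Matrix (Fin μ) (Fin f) F} {I : Fin ν → Finset (Fin n)}

theorem exists_linearEquiv_span_row {d : ℕ} (hV : V.rank = d + 1) (v : Fin μ) :
    ∃ η : (F × (Fin d → F)) ≃ₗ[F] Submodule.span F (Set.range V.row),
      V v ≠ 0 → (η (1, 0) : Fin f → F) = V v := by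
  have finrank_eq : Module.finrank F (F × (Fin d → F)) =
      Module.finrank F (Submodule.span F (Set.range V.row)) := by
    rw [← Matrix.rank_eq_finrank_span_row, hV, Module.finrank_prod, Module.finrank_self,
      Module.finrank_fin_fun, add_comm]
  by_cases hv : V v = 0
  · exact ⟨.ofFinrankEq _ _ finrank_eq, fun h => absurd hv h⟩
  · obtain ⟨η, hη⟩ := exists_linearEquiv_apply_eq finrank_eq (x := (1, 0))
      (y := ⟨V v, Submodule.subset_span ⟨v, rfl⟩⟩) (by simp) (by simpa using hv)
    exact ⟨η, fun _ => congrArg Subtype.val hη⟩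

variable [Fintype F]

theorem IsUniformCover.exists_protocol (hI : IsUniformCover G I κ) (hκν : κ < ν)
    (hV : V.rank ≠ 0) :
    ∃ P : Protocol G V (ν ^ V.rank), ∑ j, (P.answerSize j : ℝ) =
      (ν ^ V.rank * k : ℕ) * ∑ i ∈ Finset.range V.rank, (κ / ν : ℝ) ^ i := by
  obtain ⟨d, rank_eq⟩ := Nat.exists_eq_succ_of_ne_zero hV
  rw [rank_eq]
  let E := Submodule.span F (Set.range V.row)
  have finrank_E : Module.finrank F E = d + 1 := by rw [← Matrix.rank_eq_finrank_span_row, rank_eq]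
  choose η hη using exists_linearEquiv_span_row rank_eq
  obtain ⟨σ⟩ := hI.nonempty_pairings (d := d)
  let S := Blocks F (Fin d → F) d ν (blockCount d κ (ν - κ))
  have : Nonempty ((Fin (ν ^ (d + 1)) → F) ≃ₗ[F] S) :=
    ⟨.ofFinrankEq _ _ (by rw [Module.finrank_fin_fun, finrank_blocks hκν.le])⟩
  have : Finite S := Module.finite_of_finite F
  have : Finite ((Fin (ν ^ (d + 1)) → F) ≃ₗ[F] S) := DFunLike.finite _
  have := Fintype.ofFinite ((Fin (ν ^ (d + 1)) → F) ≃ₗ[F] S)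
  exact ⟨{ toScheme := alternatingScheme σ E.subtype η
           isPrivate := alternatingScheme_isPrivate σ E.subtype η G V
           isRecoverable := alternatingScheme_isRecoverable hI.isInformationSet σ E.subtype η hη },
    (hI.sum_finrank_responses hκν finrank_E).trans (by push_cast; rfl)⟩

theorem inv_geom_sum_eq {K : Type*} [Field K] {x : K} (hx : x ≠ 1) (r : ℕ) :
    (∑ i ∈ Finset.range r, x ^ i)⁻¹ = (1 - x) * (1 - x ^ r)⁻¹ := by
  rw [geom_sum_eq hx, inv_div, ← neg_div_neg_eq, neg_sub, neg_sub, div_eq_mul_inv]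

theorem div_le_inv_of_mul_le {K : Type*} [Field K] [LinearOrder K] [IsStrictOrderedRing K]
    {a b c : K} (ha : 0 ≤ a) (hb : 0 < b) (h : a * b ≤ c) : a / c ≤ b⁻¹ :=
  div_le_of_le_mul₀ ((mul_nonneg ha hb.le).trans h) (inv_nonneg.2 hb.le)
    ((le_inv_mul_iff₀' hb).2 h)

namespace Protocol

variable (P : Protocol G V β)

theorem sum_entropy_le_sum_answerSize (v : Fin μ) :
    ∑ j, entropy (Fintype.card F) (P.law k v) (fun x => P.reply G x j) ≤
      ∑ j, (P.answerSize j : ℝ) :=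
  Finset.sum_le_sum fun _ _ =>
    (entropy_le_finrank _ _).trans_eq (congrArg Nat.cast (Module.finrank_fin_fun F))

theorem entropyRate_le (hI : IsUniformCover G I κ) (hν : 0 < ν) (hV : V.rank ≠ 0) (v : Fin μ) :
    P.entropyRate v ≤ (∑ i ∈ Finset.range V.rank, (κ / ν : ℝ) ^ i)⁻¹ :=
  div_le_inv_of_mul_le (Nat.cast_nonneg _) (geom_sum_pos (by positivity) hV)
    (by simpa using P.mul_sum_pow_rank_le_sum_entropy hI hν v)

theorem rate_le (hI : IsUniformCover G I κ) (hν : 0 < ν) (hV : V.rank ≠ 0) :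
    P.rate ≤ (∑ i ∈ Finset.range V.rank, (κ / ν : ℝ) ^ i)⁻¹ := by
  have v : Fin μ := ⟨0, (Nat.pos_of_ne_zero hV).trans_le V.rank_le_height⟩
  have converse := P.mul_sum_pow_rank_le_sum_entropy hI hν v
  rw [← Nat.cast_mul] at converse
  exact div_le_inv_of_mul_le (Nat.cast_nonneg _) (geom_sum_pos (by positivity) hV)
    (converse.trans (P.sum_entropy_le_sum_answerSize v))

end Protocol

theorem IsUniformCover.exists_protocol_rate_eq (hI : IsUniformCover G I κ) (hk : 0 < k)
    (hκν : κ < ν) (hV : V.rank ≠ 0) :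
    ∃ β, 0 < β ∧ ∃ P : Protocol G V β,
      P.rate = (∑ i ∈ Finset.range V.rank, (κ / ν : ℝ) ^ i)⁻¹ ∧
        ∀ v, P.entropyRate v = (∑ i ∈ Finset.range V.rank, (κ / ν : ℝ) ^ i)⁻¹ := by
  have hν : 0 < ν := Nat.zero_lt_of_lt hκν
  obtain ⟨P, sum_answerSize⟩ := hI.exists_protocol hκν hV
  have sum_entropy (v : Fin μ) :
      ∑ j, entropy (Fintype.card F) (P.law k v) (fun x => P.reply G x j) =
        (ν ^ V.rank * k : ℕ) * ∑ i ∈ Finset.range V.rank, (κ / ν : ℝ) ^ i := by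
    refine le_antisymm ((P.sum_entropy_le_sum_answerSize v).trans_eq sum_answerSize) ?_
    rw [Nat.cast_mul]
    exact P.mul_sum_pow_rank_le_sum_entropy hI hν v
  have length_ne : ((ν ^ V.rank * k : ℕ) : ℝ) ≠ 0 := by positivity
  refine ⟨ν ^ V.rank, Nat.pow_pos hν, P, ?_, fun v => ?_⟩
  · rw [Protocol.rate, sum_answerSize, div_mul_cancel_left₀ length_ne]
  · rw [Protocol.entropyRate, sum_entropy, div_mul_cancel_left₀ length_ne]

end Capacity

end PLC

theorem theorem2 {F : Type*} [Field F] [Fintype F] {n k f μ r : ℕ} (hk : 0 < k) (hkn : k < n)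
    (G : Matrix (Fin k) (Fin n) F) (hG : PLC.IsGeneratorMatrix G)
    (hC : PLC.IsMDSPIRCapacityAchieving G)
    (V : Matrix (Fin μ) (Fin f) F) (hV : V.rank = r) (hr : 0 < r) :
    PLC.IsCapacity G V ((1 - (k : ℝ) / n) * (1 - ((k : ℝ) / n) ^ r)⁻¹) := by
  have hn : 0 < n := hk.trans hkn
  obtain ⟨κ, ν, I, hν, hI⟩ := hC.exists_isUniformCover hn
  have ratio_eq : (k : ℝ) / n = κ / ν := by
    rw [div_eq_div_iff (by positivity) (by positivity)]
    exact_mod_cast hI.mul_eq.symm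
  have ratio_ne_one : (k : ℝ) / n ≠ 1 :=
    ((div_lt_one (Nat.cast_pos.2 hn)).2 (Nat.cast_lt.2 hkn)).ne
  rw [← PLC.inv_geom_sum_eq ratio_ne_one, ratio_eq]
  subst hV
  have v : Fin μ := ⟨0, hr.trans_le V.rank_le_height⟩
  obtain ⟨β, hβ, P, rate_eq, entropyRate_eq⟩ :=
    hI.exists_protocol_rate_eq hk (hI.lt hkn hν) hr.ne'
  refine ⟨⟨⟨β, hβ, P, rate_eq.symm⟩, ?_⟩, ⟨⟨β, hβ, P, v, (entropyRate_eq v).symm⟩, ?_⟩⟩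
  · rintro _ ⟨β, -, P, rfl⟩
    exact P.rate_le hI hν hr.ne'
  · rintro _ ⟨β, -, P, v, rfl⟩
    exact P.entropyRate_le hI hν hr.ne' v
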